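/- **Conventions.** $\lambda$ is the security parameter and $\log=\log_2$. A function $f:\mathbb N\to\mathbb R$ is *negligible* if $f(\lambda)=O(\lambda^{-c})$ for every $c>0$. $D_{\mathbb Z,\sigma}$ ($\sigma>0$) is the discrete Gaussian on $\mathbb Z$, with probabilities proportional to $e^{-x^2/(2\sigma^2)}$. For $\mathbf A\in\mathbb Z_q^{n\times m}$ and $\mathbf y\in\mathbb Z_q^n$, $\mathbf A_\sigma^{-1}(\mathbf y)$ is the distribution of $\mathbf x\leftarrow D_{\mathbb Z,\sigma}^m$ conditioned on $\mathbf A\mathbf x=\mathbf y \bmod q$ (with any convention, say the point mass at $\mathbf 0$, if there is no solution). With $m=n\lceil\log q\rceil$, $\mathbf G=\mathbf I_n\otimes(1,2,\dots,2^{\lceil\log q\rceil-1})\in\mathbb Z_q^{n\times m}$ is the gadget matrix and $\mathbf G^{-1}(\mathbf v)\in\{0,1\}^m$ is the binary expansion of $\mathbf v\in\mathbb Z_q^n$. **Parameters.** Let $n,q,m',L$ be functions of $\lambda$ with values in $\mathbb N$ and $\chi,\chi'$ functions of $\lambda$ with positive real values, where every $q(\lambda)>2$ is prime, $m=n\lceil\log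 q\rceil$ and $m'$ are polynomially bounded in $\lambda$, and $2^{-n(\lambda)}$ is negligible. Let $\chi_0(n,q)=\sqrt{n\log q}\cdot g(n)$ with $g(n)=\omega(\sqrt{\log n})$ (and $g$ eventually positive). **Trapdoors.** Let $(\mathsf{TrapGen},\mathsf{SamplePre})$ be any pair of randomized algorithms such that for all $n\ge1$, all primes $q>2$ and $m=n\lceil\log q\rceil$: (i) $\mathsf{TrapGen}(1^n,1^m,q)$ outputs a pair $(\mathbf A,\mathsf{td})$ in which $\mathbf A\in\mathbb Z_q^{n\times m}$ has statistical distance at most $2^{-n}$ from uniform; (ii) for all $\sigma>0$ with $\sigma\ge\chi_0(n,q)$ and all $\mathbf y\in\mathbb Z_q^n$, if $(\mathbf A,\mathsf{td})\leftarrow\mathsf{TrapGen}(1^n,1^m,q)$, then $(\mathbf A,\mathsf{td},\mathsf{SamplePre}(\mathbf A,\mathsf{td},\mathbf y,\sigma))$ has statistical distance at most $2^{-n}$ from $(\mathbf A,\mathsf{td},\mathbf x)$ with $\mathbf x\leftarrow\mathbf A_\sigma^{-1}(\mathbf y)$. **The scheme** (for subset policies, in the random oracle model). Authority identifiers and user identifiers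 are the bit strings in $\{0,1\}^\lambda$. - *GlobalSetup*: publish the parameters and a random oracle $\mathsf H:\{0,1\}^\lambda\times\mathbb Z_q^n\to\mathbb Z_q^{m'}$ whose values are independent samples of $D_{\mathbb Z,\chi'}^{m'}$ reduced modulo $q$. - *AuthSetup*, for each authority $a$: $(\mathbf A_a,\mathsf{td}_a)\leftarrow\mathsf{TrapGen}(1^n,1^m,q)$, and uniform $\mathbf B_a\in\mathbb Z_q^{n\times m'}$, $\mathbf P_a\in\mathbb Z_q^{n\times m}$; the public key is $(\mathbf A_a,\mathbf B_a,\mathbf P_a)$ and the master secret key is $\mathsf{td}_a$. - *Keygen*, for authority $a$, user $\mathsf{gid}$ and key vector $\mathbf v$: with $\mathbf r=\mathsf H(\mathsf{gid},\mathbf v)$, output $\mathbf k_a\leftarrow\mathsf{SamplePre}(\mathbf A_a,\mathsf{td}_a,\mathbf P_a\mathbf G^{-1}(\mathbf v)+\mathbf B_a\mathbf r,\chi)$. - *Enc*, for a set $A$ of authorities (the attributes of the ciphertext) and a plaintext $\mathbf u\in\mathbb Z_q^n$: sample uniform $\mathbf s_a\in\mathbb Z_q^n$ and $\mathbf e_{1,a}\leftarrow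 D_{\mathbb Z,\chi}^m$ for $a\in A$, $\mathbf e_2\leftarrow D_{\mathbb Z,\chi}^{m'}$, $\mathbf e_3\leftarrow D_{\mathbb Z,\chi}^{m}$; output $\mathbf c_{1,a}^\top=\mathbf s_a^\top\mathbf A_a+\mathbf e_{1,a}^\top$ ($a\in A$), $\mathbf c_2^\top=\sum_{a\in A}\mathbf s_a^\top\mathbf B_a+\mathbf e_2^\top$, $\mathbf c_3^\top=\sum_{a\in A}\mathbf s_a^\top\mathbf P_a+\mathbf e_3^\top+\mathbf u^\top\mathbf G$. - *Dec*, with the keys for $(\mathsf{gid},\mathbf v)$ of a set $A'$ of authorities: if $A\subseteq A'$, output $\Gamma=\mathbf c_3^\top\mathbf G^{-1}(\mathbf v)+\mathbf c_2^\top\mathsf H(\mathsf{gid},\mathbf v)-\sum_{a\in A}\mathbf c_{1,a}^\top\mathbf k_a\in\mathbb Z_q$; otherwise fail. **Theorem (correctness of MA-ABevIPFE).** If $\chi(\lambda)\ge\chi_0(n(\lambda),q(\lambda))$ for all $\lambda$, then the scheme is approximately correct with error bound $$B_0=\sqrt{\lambda}\,\chi m+\lambda\chi\chi' m'+\lambda\chi^2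 mL$$ for ciphertexts with at most $L$ attributes. That is, for every polynomially bounded $\ell:\mathbb N\to\mathbb N$ there is a negligible function $\nu$ such that for all $\lambda$, all $\mathbf u,\mathbf v\in\mathbb Z_q^n$, all $\mathsf{gid}\in\{0,1\}^\lambda$, and all sets of authorities $A\subseteq A'\subseteq\{0,1\}^\lambda$ with $|A|\le L(\lambda)$ and $|A|\le\ell(\lambda)$, with probability at least $1-\nu(\lambda)$ over all the algorithms and the random oracle, decrypting an encryption of $\mathbf u$ under $A$ with the keys for $(\mathsf{gid},\mathbf v)$ of the authorities in $A'$ gives $$\Gamma=\mathbf u^\top\mathbf v+e \pmod q\quad\text{for some integer } e \text{ with } |e|\le B_0 .$$ -/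

import Mathlib

open scoped ENNReal Matrix

noncomputable section

namespace MAABIPFE

/-! ### Asymptotic notions -/

/-- `f` is negligible in the security parameter: `f(l) = O(l ^ (-c))` for every `c`. -/
def IsNegligible (f : ℕ → ℝ) : Prop :=
  Asymptotics.SuperpolynomialDecay Filter.atTop (fun l : ℕ => (l : ℝ)) f

/-- `f` is polynomially bounded in the security parameter. -/
def IsPolyBounded (f : ℕ → ℕ) : Prop :=
  ∃ c : ℕ, (fun l : ℕ => (f l : ℝ)) =O[Filter.atTop] fun l : ℕ => (l : ℝ) ^ c

/-! ### Independent sampling and statistical distance -/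

theorem tsum_pi_prod_fin {α : Type} (n : ℕ) (g : Fin n → α → ℝ≥0∞) :
    ∑' f : Fin n → α, ∏ i, g i (f i) = ∏ i, ∑' a, g i a := by
  induction n with
  | zero => simp
  | succ n ih =>
    rw [← (Fin.consEquiv fun _ : Fin (n + 1) => α).tsum_eq, Fin.prod_univ_succ, ← ih,
      ENNReal.tsum_prod']
    simp only [Fin.consEquiv_apply, Fin.prod_univ_succ, Fin.cons_zero, Fin.cons_succ,
      ENNReal.tsum_mul_left, ENNReal.tsum_mul_right]

theorem tsum_pi_prod {ι α : Type} [Fintype ι] (g : ι → α → ℝ≥0∞) :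
    ∑' f : ι → α, ∏ i, g i (f i) = ∏ i, ∑' a, g i a := by
  let e := Fintype.equivFin ι
  rw [← (e.symm.arrowCongr (Equiv.refl α)).tsum_eq, ← e.symm.prod_comp,
    ← tsum_pi_prod_fin]
  refine tsum_congr fun f => ?_
  rw [← e.symm.prod_comp]
  simp [Equiv.arrowCongr]

/-- The product distribution: the coordinates `f i` are sampled independently, `f i` from `p i`. -/
def pmfPi {ι α : Type} [Fintype ι] (p : ι → PMF α) : PMF (ι → α) :=
  ⟨fun f => ∏ i, p i (f i), by
    rw [ENNReal.summable.hasSum_iff, tsum_pi_prod]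
    simp [PMF.tsum_coe]⟩

/-- Statistical distance `(1/2) ∑ |D₁(ω) - D₂(ω)|`. -/
def statDist {Ω : Type} (D₁ D₂ : PMF Ω) : ℝ :=
  (1 / 2) * ∑' ω, |(D₁ ω).toReal - (D₂ ω).toReal|

/-! ### Discrete Gaussians -/

/-- The Gaussian weight `exp (-x² / (2 σ²))` of the integer `x`. -/
def gaussWeight (σ : ℝ) (x : ℤ) : ℝ≥0∞ :=
  ENNReal.ofReal (Real.exp (-(x : ℝ) ^ 2 / (2 * σ ^ 2)))

theorem tsum_gaussWeight_ne_zero (σ : ℝ) : ∑' x, gaussWeight σ x ≠ 0 := by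
  intro h
  have h0 := ENNReal.tsum_eq_zero.1 h 0
  simp [gaussWeight] at h0

theorem tsum_gaussWeight_ne_top {σ : ℝ} (hσ : 0 < σ) : ∑' x, gaussWeight σ x ≠ ∞ := by
  have hT : 0 < 1 / (2 * Real.pi * σ ^ 2) := by positivity
  have h := summable_pow_mul_jacobiTheta₂_term_bound 0 hT 0
  refine (h.congr fun x => ?_).tsum_ofReal_ne_top
  have hpi := Real.pi_ne_zero
  have hs := hσ.ne'
  simp only [pow_zero, one_mul]
  congr 1
  field_simp
  ring

/-- The centred discrete Gaussian distribution over `ℤ` with standard deviation `σ > 0`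
(for `σ ≤ 0`, where there is no such distribution, the point mass at `0`). -/
def discreteGaussian (σ : ℝ) : PMF ℤ :=
  if h : 0 < σ then
    PMF.normalize (gaussWeight σ) (tsum_gaussWeight_ne_zero σ) (tsum_gaussWeight_ne_top h)
  else PMF.pure 0

/-- An integer vector with independent discrete Gaussian entries. -/
def gaussVec (m : ℕ) (σ : ℝ) : PMF (Fin m → ℤ) :=
  pmfPi fun _ => discreteGaussian σ

/-- Entrywise reduction modulo `q`. -/
def modVec {m : ℕ} (q : ℕ) (x : Fin m → ℤ) : Fin m → ZMod q := fun i => (x i : ZMod q)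

open Classical in
/-- The distribution of `x ← D_{ℤ,σ}^m` conditioned on `A x = y mod q`
(the point mass at `0` if `A x = y` has no solution). -/
def preimageGaussian {n m q : ℕ} (A : Matrix (Fin n) (Fin m) (ZMod q)) (σ : ℝ)
    (y : Fin n → ZMod q) : PMF (Fin m → ℤ) :=
  if h : ∃ x ∈ {x : Fin m → ℤ | A *ᵥ modVec q x = y}, x ∈ (gaussVec m σ).support then
    (gaussVec m σ).filter {x | A *ᵥ modVec q x = y} h
  else PMF.pure 0

/-! ### The gadget matrix -/

/-- `n ⌈log₂ q⌉`, the number of columns of the gadget matrix. -/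
abbrev gadgetLen (n q : ℕ) : ℕ := n * Nat.clog 2 q

/-- The gadget matrix `I_n ⊗ (1, 2, …, 2^(⌈log₂ q⌉ - 1))`. -/
def gadget (n q : ℕ) : Matrix (Fin n) (Fin (gadgetLen n q)) (ZMod q) :=
  fun i c => if (finProdFinEquiv.symm c).1 = i then 2 ^ ((finProdFinEquiv.symm c).2 : ℕ) else 0

/-- Concatenation of the binary expansions (least significant bit first) of the entries of `v`. -/
def gadgetInv {n q : ℕ} (v : Fin n → ZMod q) : Fin (gadgetLen n q) → ZMod q :=
  fun c => if (v (finProdFinEquiv.symm c).1).val.testBit (finProdFinEquiv.symm c).2 then 1 else 0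

/-! ### Lattice trapdoors -/

/-- The syntax of a pair of randomized algorithms `(TrapGen, SamplePre)`. -/
structure TrapdoorAlgorithms where
  /-- the type of trapdoors -/
  Td : ℕ → ℕ → ℕ → Type
  /-- `TrapGen(1^n, 1^m, q) → (A, td)` -/
  trapGen : ∀ n m q : ℕ, PMF (Matrix (Fin n) (Fin m) (ZMod q) × Td n m q)
  /-- `SamplePre(A, td, y, σ) → x` -/
  samplePre : ∀ {n m q : ℕ}, Matrix (Fin n) (Fin m) (ZMod q) → Td n m q →
    (Fin n → ZMod q) → ℝ → PMF (Fin m → ℤ)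

/-- `(TrapGen, SamplePre)` is a lattice trapdoor for the width threshold `χ₀`: for all `n ≥ 1`,
primes `q > 2` and `m = n ⌈log₂ q⌉`,
* the matrix output by `TrapGen` is `2^(-n)`-close to uniform;
* for every width `σ ≥ χ₀(n, q)` and target `y`, when `(A, td) ← TrapGen`, the output of
  `SamplePre(A, td, y, σ)` is, jointly with `(A, td)`, `2^(-n)`-close to a sample of `A_σ⁻¹(y)`. -/
def TrapdoorAlgorithms.IsTrapdoor (T : TrapdoorAlgorithms) (χ₀ : ℕ → ℕ → ℝ) : Prop :=
  ∀ (n q : ℕ) [Fact q.Prime], 0 < n → 2 < q →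
    statDist ((T.trapGen n (gadgetLen n q) q).map Prod.fst)
        (PMF.uniformOfFintype (Matrix (Fin n) (Fin (gadgetLen n q)) (ZMod q))) ≤ (2 ^ n)⁻¹ ∧
    ∀ σ : ℝ, 0 < σ → χ₀ n q ≤ σ → ∀ y : Fin n → ZMod q,
      statDist
        ((T.trapGen n (gadgetLen n q) q).bind fun At =>
          (T.samplePre At.1 At.2 y σ).map fun x => (At, x))
        ((T.trapGen n (gadgetLen n q) q).bind fun At =>
          (preimageGaussian At.1 σ y).map fun x => (At, x)) ≤ (2 ^ n)⁻¹

open Classical in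
/-- The notion is satisfiable: a uniform matrix with exact (not necessarily efficient)
conditional sampling is a lattice trapdoor for every threshold. -/
theorem exists_isTrapdoor (χ₀ : ℕ → ℕ → ℝ) : ∃ T : TrapdoorAlgorithms, T.IsTrapdoor χ₀ := by
  refine ⟨⟨fun _ _ _ => Unit,
    fun n m q => if h : q = 0 then PMF.pure (0, ()) else
      haveI : NeZero q := ⟨h⟩
      (PMF.uniformOfFintype (Matrix (Fin n) (Fin m) (ZMod q))).map fun A => (A, ()),
    fun A _ y σ => preimageGaussian A σ y⟩, ?_⟩
  intro n q hq _ _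
  have hq0 : q ≠ 0 := hq.out.ne_zero
  constructor
  · simp only [hq0, dite_false, PMF.map_comp]
    rw [show (Prod.fst ∘ fun A : Matrix (Fin n) (Fin (gadgetLen n q)) (ZMod q) => (A, ())) = id
      from rfl, PMF.map_id]
    simp [statDist]
  · intro σ _ _ y
    simp [statDist]

/-! ### Multi-authority attribute-based (noisy / evasive) IPFE for subset policies -/

/-- The syntax (at a fixed security parameter) of a multi-authority attribute-based inner-product
functional encryption scheme for subset policies over `ℤ_q^n`, with authority universe `AU` and
user identifiers `GID`.  Decryption may fail, which is the output `none`. -/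
structure Scheme (n q : ℕ) (AU GID : Type) where
  /-- global parameters -/
  GP : Type
  /-- public keys of authorities -/
  PK : Type
  /-- master secret keys of authorities -/
  MSK : Type
  /-- secret keys of users -/
  SK : Type
  /-- ciphertexts -/
  CT : Type
  globalSetup : PMF GP
  authSetup : GP → AU → PMF (PK × MSK)
  keygen : GP → PK → MSK → GID → (Fin n → ZMod q) → PMF SK
  enc : GP → (A : Finset AU) → (A → PK) → (Fin n → ZMod q) → PMF CT
  dec : GP → (A' : Finset AU) → (A' → SK) → GID → (Fin n → ZMod q) → CT →
    PMF (Option (ZMod q))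

/-- The result of honestly decrypting, with the keys for `(gid, v)` of the authorities in `A'`,
an encryption of `u` under the authorities in `A ⊆ A'`. -/
def Scheme.decryption {n q : ℕ} {AU GID : Type} (S : Scheme n q AU GID)
    (u v : Fin n → ZMod q) (gid : GID) (A A' : Finset AU) (hA : A ⊆ A') :
    PMF (Option (ZMod q)) :=
  S.globalSetup.bind fun gp =>
  (pmfPi fun a : A' => S.authSetup gp a).bind fun keys =>
  (pmfPi fun a : A' => S.keygen gp (keys a).1 (keys a).2 gid v).bind fun sks =>
  (S.enc gp A (fun a => (keys ⟨a, hA a.2⟩).1) u).bind fun ct =>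
  S.dec gp A' sks gid v ct

/-- The event that a decryption result equals `μ + e` for an integer error `|e| ≤ B`. -/
def approxEvent {q : ℕ} (μ : ZMod q) (B : ℝ) : Set (Option (ZMod q)) :=
  {Γ | ∃ e : ℤ, |(e : ℝ)| ≤ B ∧ Γ = some (μ + (e : ZMod q))}

/-- Approximate correctness with decryption noise bounded by `B₀`, for ciphertexts associated with
at most `L` attributes.  As encryption takes the list of public keys as its input, the number of
attributes of a ciphertext is in addition polynomially bounded (by an arbitrary polynomial `ℓ`,
on which the negligible function may depend). -/
def IsApproxCorrect {n q : ℕ → ℕ} {AU GID : ℕ → Type}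
    (S : ∀ l, Scheme (n l) (q l) (AU l) (GID l)) (L : ℕ → ℕ) (B₀ : ℕ → ℝ) : Prop :=
  ∀ ℓ : ℕ → ℕ, IsPolyBounded ℓ → ∃ ν : ℕ → ℝ, IsNegligible ν ∧
    ∀ (l : ℕ) (u v : Fin (n l) → ZMod (q l)) (gid : GID l) (A A' : Finset (AU l)) (hA : A ⊆ A'),
      A.card ≤ L l → A.card ≤ ℓ l →
      1 - ν l ≤
        (((S l).decryption u v gid A A' hA).toOuterMeasure (approxEvent (u ⬝ᵥ v) (B₀ l))).toReal

/-! ### The scheme -/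

/-- Bit strings of length `l`: the authority identifiers and the global user identifiers. -/
abbrev BitString (l : ℕ) : Type := Fin l → Bool

/-- The random oracle `H : GID × ℤ_q^n → ℤ_q^{m'}`: on each input, the output is an independent
sample of the discrete Gaussian `D_{ℤ,χ'}^{m'}`, reduced modulo `q`. -/
def randomOracle (l n q m' : ℕ) [NeZero q] (χ' : ℝ) :
    PMF (BitString l × (Fin n → ZMod q) → (Fin m' → ZMod q)) :=
  pmfPi fun _ => (gaussVec m' χ').map (modVec q)

/-- The public key `(A, B, P)` of an authority. -/
abbrev PublicKey (n q m' : ℕ) : Type :=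
  Matrix (Fin n) (Fin (gadgetLen n q)) (ZMod q) × Matrix (Fin n) (Fin m') (ZMod q) ×
    Matrix (Fin n) (Fin (gadgetLen n q)) (ZMod q)

/-- A ciphertext: the set `A` of its attributes, `(c_{1,aid})_{aid ∈ A}`, `c₂` and `c₃`. -/
structure Ciphertext (l n q m' : ℕ) where
  attrs : Finset (BitString l)
  c₁ : attrs → Fin (gadgetLen n q) → ZMod q
  c₂ : Fin m' → ZMod q
  c₃ : Fin (gadgetLen n q) → ZMod q

/-- The `MA-ABevIPFE` scheme at security parameter `l`, with lattice parameters `n, q`,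
`m = n ⌈log₂ q⌉`, `m'`, `χ`, `χ'`.  These are public constants, so that the only component of the
global parameters that has to be sampled is the random oracle `H`. -/
def evIPFE (T : TrapdoorAlgorithms) (l n q m' : ℕ) [NeZero q] (χ χ' : ℝ) :
    Scheme n q (BitString l) (BitString l) where
  GP := BitString l × (Fin n → ZMod q) → (Fin m' → ZMod q)
  PK := PublicKey n q m'
  MSK := T.Td n (gadgetLen n q) q
  SK := Fin (gadgetLen n q) → ℤ
  CT := Ciphertext l n q m'
  globalSetup := randomOracle l n q m' χ'
  authSetup := fun _ _ =>
    (T.trapGen n (gadgetLen n q) q).bind fun At =>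
    (PMF.uniformOfFintype (Matrix (Fin n) (Fin m') (ZMod q))).bind fun B =>
    (PMF.uniformOfFintype (Matrix (Fin n) (Fin (gadgetLen n q)) (ZMod q))).bind fun P =>
    PMF.pure ((At.1, B, P), At.2)
  keygen := fun H pk td gid v =>
    T.samplePre pk.1 td (pk.2.2 *ᵥ gadgetInv v + pk.2.1 *ᵥ H (gid, v)) χ
  enc := fun _ A pk u =>
    (pmfPi fun _ : A => PMF.uniformOfFintype (Fin n → ZMod q)).bind fun s =>
    (pmfPi fun _ : A => gaussVec (gadgetLen n q) χ).bind fun e₁ =>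
    (gaussVec m' χ).bind fun e₂ =>
    (gaussVec (gadgetLen n q) χ).bind fun e₃ =>
    PMF.pure
      { attrs := A
        c₁ := fun a => s a ᵥ* (pk a).1 + modVec q (e₁ a)
        c₂ := (∑ a, s a ᵥ* (pk a).2.1) + modVec q e₂
        c₃ := (∑ a, s a ᵥ* (pk a).2.2) + modVec q e₃ + u ᵥ* gadget n q }
  dec := fun H A' k gid v ct =>
    PMF.pure <|
      if h : ct.attrs ⊆ A' then
        some (ct.c₃ ⬝ᵥ gadgetInv v + ct.c₂ ⬝ᵥ H (gid, v)
          - ∑ a : ct.attrs, ct.c₁ a ⬝ᵥ modVec q (k ⟨a, h a.2⟩))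
      else none

/-- The noise bound `√λ χ m + λ χ χ' m' + λ χ² m L` with `m = n ⌈log₂ q⌉`. -/
def noiseBound (l n q m' L : ℕ) (χ χ' : ℝ) : ℝ :=
  √(l : ℝ) * χ * gadgetLen n q + l * χ * χ' * m' + l * χ ^ 2 * gadgetLen n q * L

end MAABIPFE

end

noncomputable section

namespace MAABIPFE

/-! ### Probabilities of events -/

/-! If every key satisfies `A_a k_a = P_a G⁻¹(v) + B_a r` exactly, the secrets `s_a` cancel in
decryption and leave `u·v` plus `e₃·G⁻¹(v) + e₂·r - ∑ e_{1,a}·k_a` (`decryption_identity`). If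
moreover all entries of the Gaussian vectors and of the keys are at most `√λ` times their width, the
three terms are bounded by the three summands of `B₀` (`abs_noise_le`). A Gaussian entry breaks this
with probability at most `2 exp(-λ/2)`, so a union bound settles everything except the keys.

For the keys, the trapdoor properties allow `SamplePre` to be replaced by the conditioned Gaussian
and `A_a` by a uniform matrix, at a cost of order `2^(-n)`. What remains is that for uniform `A` and
fixed `y` the Gaussian conditioned on `A x = y` is short (`tsum_uniform_preimageGaussian_le`). This
follows from a second-moment argument: the vectors `A x` and `A x'` are independent unless `x, x'`
are proportional mod `q`, so by Chebyshev the solutions have mass at least `1/(4qⁿ)` for all but a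
few `A` (`card_light_matrices_le`). The long solutions that are nonzero mod `q` have expected mass
at most `q⁻ⁿ` times the tail, and dividing costs only a factor `4`. Vectors that vanish mod `q`
solve `A x = 0` for every `A`; they are handled by a tail bound relative to the lattice `qℤ^m`.

Chebyshev needs each residue vector to have mass well below `q^(-n-1)`. As `q ≥ 3`, a wide Gaussian
gives each residue class mass close to at most `1/3`, and `m = n⌈log q⌉` coordinates suffice. The
width is large for all large `λ` because `n → ∞`. -/

theorem toOuterMeasure_le_one {α : Type} (p : PMF α) (S : Set α) : p.toOuterMeasure S ≤ 1 := by
  rw [PMF.toOuterMeasure_apply, ← p.tsum_coe]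
  exact ENNReal.tsum_le_tsum fun a => Set.indicator_le_self _ _ a

theorem toOuterMeasure_eq_tsum_mul {α : Type} (p : PMF α) (S : Set α) :
    p.toOuterMeasure S = ∑' a, p a * S.indicator 1 a := by
  rw [PMF.toOuterMeasure_apply]
  refine tsum_congr fun a => ?_
  by_cases h : a ∈ S <;> simp [h]

theorem one_sub_le_toOuterMeasure {α : Type} (p : PMF α) (S : Set α) {ν : ℝ} (hν : 0 ≤ ν)
    (h : p.toOuterMeasure Sᶜ ≤ ENNReal.ofReal ν) : 1 - ν ≤ (p.toOuterMeasure S).toReal := by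
  have h1 : (1 : ℝ≥0∞) ≤ p.toOuterMeasure S + ENNReal.ofReal ν := by
    refine le_trans ?_ (add_le_add_right h _)
    refine le_trans (le_of_eq ?_) (MeasureTheory.measure_union_le (μ := p.toOuterMeasure) S Sᶜ)
    rw [Set.union_compl_self, eq_comm, PMF.toOuterMeasure_apply_eq_one_iff]
    exact Set.subset_univ _
  have hS : p.toOuterMeasure S ≠ ∞ := ((toOuterMeasure_le_one p S).trans_lt ENNReal.one_lt_top).ne
  have h2 := ENNReal.toReal_mono (by simp [hS]) h1
  rw [ENNReal.toReal_add hS (by simp), ENNReal.toReal_ofReal hν, ENNReal.toReal_one] at h2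
  linarith

/-- The part `g` of the bound that depends on the outcome is averaged over `p`. This form serves key
generation, where the failure probability is small only on average over the authority's keys. -/
theorem toOuterMeasure_bind_le {α β : Type} (p : PMF α) (f : α → PMF β) (S : Set β)
    (g : α → ℝ≥0∞) (ε : ℝ≥0∞) (h : ∀ a, (f a).toOuterMeasure S ≤ g a + ε) :
    (p.bind f).toOuterMeasure S ≤ ∑' a, p a * g a + ε := by
  rw [PMF.toOuterMeasure_bind_apply]
  calc ∑' a, p a * (f a).toOuterMeasure S ≤ ∑' a, (p a * g a + p a * ε) :=
        ENNReal.tsum_le_tsum fun a => by rw [← mul_add]; gcongr; exact h a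
    _ = _ := by rw [ENNReal.tsum_add, ENNReal.tsum_mul_right, p.tsum_coe, one_mul]

theorem toOuterMeasure_bind_le_add {α β : Type} (p : PMF α) (f : α → PMF β) (S : Set β)
    (B : Set α) (ε : ℝ≥0∞) (h : ∀ a, a ∉ B → (f a).toOuterMeasure S ≤ ε) :
    (p.bind f).toOuterMeasure S ≤ p.toOuterMeasure B + ε := by
  rw [toOuterMeasure_eq_tsum_mul p B]
  refine toOuterMeasure_bind_le p f S _ ε fun a => ?_
  by_cases ha : a ∈ B
  · simpa [ha] using (toOuterMeasure_le_one _ _).trans (le_add_right le_rfl)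
  · simpa [ha] using h a ha

theorem tsum_bind_mul {α β : Type} (p : PMF α) (f : α → PMF β) (h : β → ℝ≥0∞) :
    ∑' b, p.bind f b * h b = ∑' a, p a * ∑' b, f a b * h b := by
  simp_rw [PMF.bind_apply, ← ENNReal.tsum_mul_right, ← ENNReal.tsum_mul_left]
  rw [ENNReal.tsum_comm]
  simp_rw [mul_assoc]

theorem tsum_pure_mul {α : Type} (a : α) (h : α → ℝ≥0∞) : ∑' b, PMF.pure a b * h b = h a := by
  rw [tsum_eq_single a]
  · simp
  · intro b hb
    simp [hb]

theorem tsum_map_mul {α β : Type} (p : PMF α) (f : α → β) (h : β → ℝ≥0∞) :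
    ∑' b, p.map f b * h b = ∑' a, p a * h (f a) := by
  rw [PMF.map, tsum_bind_mul]
  exact tsum_congr fun a => by rw [Function.comp_apply, tsum_pure_mul]

theorem tsum_mul_le_of_le {α : Type} (p : PMF α) {h : α → ℝ≥0∞} {c : ℝ≥0∞} (hc : ∀ a, h a ≤ c) :
    ∑' a, p a * h a ≤ c := by
  calc ∑' a, p a * h a ≤ ∑' a, p a * c := ENNReal.tsum_le_tsum fun a => by gcongr; exact hc a
    _ = c := by rw [ENNReal.tsum_mul_right, p.tsum_coe, one_mul]

/-- Statistically close distributions give close expectations to functions bounded by `1`. -/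
theorem tsum_mul_le_add_statDist {Ω : Type} (P Q : PMF Ω) {h : Ω → ℝ≥0∞} (hh : ∀ ω, h ω ≤ 1)
    {d : ℝ} (hd : statDist P Q ≤ d) :
    ∑' ω, P ω * h ω ≤ ∑' ω, Q ω * h ω + ENNReal.ofReal (2 * d) := by
  have hsum : ∀ R : PMF Ω, Summable fun ω => (R ω).toReal := fun R =>
    ENNReal.summable_toReal (by simp [R.tsum_coe])
  have hs : Summable fun ω => |(P ω).toReal - (Q ω).toReal| := ((hsum P).sub (hsum Q)).abs
  have hle : ∀ ω, P ω ≤ Q ω + ENNReal.ofReal |(P ω).toReal - (Q ω).toReal| := fun ω => by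
    rw [← ENNReal.ofReal_toReal (P.apply_ne_top ω), ← ENNReal.ofReal_toReal (Q.apply_ne_top ω),
      ← ENNReal.ofReal_add ENNReal.toReal_nonneg (abs_nonneg _)]
    refine ENNReal.ofReal_le_ofReal ?_
    rw [ENNReal.toReal_ofReal ENNReal.toReal_nonneg, ENNReal.toReal_ofReal ENNReal.toReal_nonneg]
    linarith [le_abs_self ((P ω).toReal - (Q ω).toReal)]
  calc ∑' ω, P ω * h ω
      ≤ ∑' ω, (Q ω * h ω + ENNReal.ofReal |(P ω).toReal - (Q ω).toReal|) := by
        refine ENNReal.tsum_le_tsum fun ω => ?_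
        calc P ω * h ω ≤ (Q ω + ENNReal.ofReal |(P ω).toReal - (Q ω).toReal|) * h ω := by
              gcongr; exact hle ω
          _ ≤ _ := by rw [add_mul]; gcongr; exact mul_le_of_le_one_right' (hh ω)
    -- The whole `ℓ¹` distance is used instead of its positive part, hence `2 * statDist`; the lost
    -- factor 2 is harmless.
    _ = ∑' ω, Q ω * h ω + ENNReal.ofReal (2 * statDist P Q) := by
        rw [ENNReal.tsum_add, ← ENNReal.ofReal_tsum_of_nonneg (fun _ => abs_nonneg _) hs, statDist]
        congr 2; ring
    _ ≤ _ := by gcongr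

/-! ### Product distributions -/

theorem pmfPi_apply {ι α : Type} [Fintype ι] (p : ι → PMF α) (f : ι → α) :
    pmfPi p f = ∏ i, p i (f i) := rfl

theorem tsum_pmfPi_mul {ι α : Type} [Fintype ι] (p : ι → PMF α) (j : ι) (h : α → ℝ≥0∞) :
    ∑' f, pmfPi p f * h (f j) = ∑' a, p j a * h a := by
  classical
  have := tsum_pi_prod fun i a => p i a * if i = j then h a else 1
  simp_rw [Finset.prod_mul_distrib, Finset.prod_ite_eq', Finset.mem_univ, if_true] at this
  simp_rw [pmfPi_apply, this]
  rw [← Finset.mul_prod_erase _ _ (Finset.mem_univ j), Finset.prod_eq_one, mul_one]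
  · simp
  · intro i hi
    simp [Finset.ne_of_mem_erase hi, PMF.tsum_coe]

theorem toOuterMeasure_pmfPi_coord {ι α : Type} [Fintype ι] (p : ι → PMF α) (j : ι) (S : Set α) :
    (pmfPi p).toOuterMeasure {f | f j ∈ S} = (p j).toOuterMeasure S := by
  rw [toOuterMeasure_eq_tsum_mul, toOuterMeasure_eq_tsum_mul]
  exact tsum_pmfPi_mul p j (S.indicator 1)

/-- The union runs over a subset `s` of the coordinates: the authorities in `A'` outside `A` may be
exponentially many and must not enter the bound. -/
theorem toOuterMeasure_pmfPi_exists_le {ι α : Type} [Fintype ι] (p : ι → PMF α) (s : Finset ι)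
    (S : ι → Set α) :
    (pmfPi p).toOuterMeasure {f | ∃ i ∈ s, f i ∈ S i} ≤ ∑ i ∈ s, (p i).toOuterMeasure (S i) := by
  have : {f : ι → α | ∃ i ∈ s, f i ∈ S i} = ⋃ i ∈ s, {f | f i ∈ S i} := by ext; simp
  rw [this]
  refine (MeasureTheory.measure_biUnion_finset_le s _).trans (le_of_eq ?_)
  exact Finset.sum_congr rfl fun i _ => toOuterMeasure_pmfPi_coord p i (S i)

theorem toOuterMeasure_pmfPi_forall {ι α : Type} [Fintype ι] (p : ι → PMF α) (S : ι → Set α) :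
    (pmfPi p).toOuterMeasure {f | ∀ i, f i ∈ S i} = ∏ i, (p i).toOuterMeasure (S i) := by
  classical
  simp_rw [toOuterMeasure_eq_tsum_mul]
  rw [← tsum_pi_prod]
  refine tsum_congr fun f => ?_
  rw [pmfPi_apply, Finset.prod_mul_distrib]
  congr 1
  by_cases h : ∀ i, f i ∈ S i
  · rw [Set.indicator_of_mem (by exact h), Finset.prod_eq_one]
    · rfl
    · intro i _; simp [h i]
  · rw [Set.indicator_of_notMem (by exact h)]
    push Not at h
    obtain ⟨i, hi⟩ := h
    exact (Finset.prod_eq_zero (Finset.mem_univ i) (by simp [hi])).symm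

/-! ### One-dimensional discrete Gaussians -/

theorem gaussWeight_le_one (σ : ℝ) (x : ℤ) : gaussWeight σ x ≤ 1 := by
  rw [gaussWeight, ENNReal.ofReal_le_one, Real.exp_le_one_iff]
  exact div_nonpos_of_nonpos_of_nonneg (by nlinarith [sq_nonneg (x : ℝ)]) (by positivity)

theorem gaussWeight_neg (σ : ℝ) (x : ℤ) : gaussWeight σ (-x) = gaussWeight σ x := by
  simp [gaussWeight]

theorem gaussWeight_le_of_sq_le (σ : ℝ) {x y : ℤ} (h : y ^ 2 ≤ x ^ 2) :
    gaussWeight σ x ≤ gaussWeight σ y := by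
  refine ENNReal.ofReal_le_ofReal (Real.exp_le_exp.2 ?_)
  have : (y : ℝ) ^ 2 ≤ (x : ℝ) ^ 2 := by exact_mod_cast h
  gcongr

/-- Shift argument for the tail: `ρ(x) ≤ exp(-t²/2σ²) ρ(x - c)` for `x ≥ c > t`. -/
theorem gaussWeight_le_shift {σ t : ℝ} (ht : 0 ≤ t) {x c : ℤ} (hc : t < c) (hx : c ≤ x) :
    gaussWeight σ x ≤ ENNReal.ofReal (Real.exp (-t ^ 2 / (2 * σ ^ 2))) * gaussWeight σ (x - c) := by
  rw [gaussWeight, gaussWeight, ← ENNReal.ofReal_mul (Real.exp_pos _).le, ← Real.exp_add]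
  refine ENNReal.ofReal_le_ofReal (Real.exp_le_exp.2 ?_)
  rw [← add_div]
  have : (c : ℝ) ≤ x := by exact_mod_cast hx
  gcongr
  push_cast
  -- `x² = (x - c)² + c² + 2c(x - c)`, where the last term is nonnegative and `c > t ≥ 0`.
  nlinarith

theorem tsum_gaussWeight_multiples_gt_le (σ : ℝ) {t : ℝ} (ht : 0 ≤ t) {k : ℕ} (hk : 0 < k) :
    ∑' j : ℤ, {j : ℤ | t < ((k * j : ℤ) : ℝ)}.indicator (fun j => gaussWeight σ (k * j)) j ≤
      ENNReal.ofReal (Real.exp (-t ^ 2 / (2 * σ ^ 2))) * ∑' j : ℤ, gaussWeight σ (k * j) := by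
  have hk' : (0 : ℝ) < k := by exact_mod_cast hk
  -- The least integer with `k * c > t`: translation by `c` carries the tail `j ≥ c` injectively
  -- into all of `ℤ`.
  set c : ℤ := ⌊t / k⌋ + 1 with hc
  have hct : t < ((k * c : ℤ) : ℝ) := by
    have := Int.lt_floor_add_one (t / k)
    rw [div_lt_iff₀ hk'] at this
    rw [hc]; push_cast; linarith
  rw [← ENNReal.tsum_mul_left, ← (Equiv.subRight c).tsum_eq
    fun j : ℤ => ENNReal.ofReal (Real.exp (-t ^ 2 / (2 * σ ^ 2))) * gaussWeight σ (k * j)]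
  refine ENNReal.tsum_le_tsum fun j => ?_
  refine Set.indicator_le' (f := fun j : ℤ => gaussWeight σ (k * j))
    (g := fun j : ℤ => ENNReal.ofReal (Real.exp (-t ^ 2 / (2 * σ ^ 2))) *
      gaussWeight σ (k * (Equiv.subRight c j))) (fun j hj => ?_) (fun _ _ => zero_le) j
  have hj' : t / k < j := by
    rw [div_lt_iff₀ hk']; have : t < ((k * j : ℤ) : ℝ) := hj; push_cast at this; linarith
  have hcj : c ≤ j := Int.floor_lt.2 hj'
  have := gaussWeight_le_shift (σ := σ) ht hct
    (mul_le_mul_of_nonneg_left hcj (Int.natCast_nonneg k))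
  simpa [mul_sub] using this

/-- Relative tail bound for the multiples of `k`. -/
theorem tsum_gaussWeight_multiples_tail_le (σ : ℝ) {t : ℝ} (ht : 0 ≤ t) {k : ℕ} (hk : 0 < k) :
    ∑' j : ℤ, {j : ℤ | t < |((k * j : ℤ) : ℝ)|}.indicator (fun j => gaussWeight σ (k * j)) j ≤
      2 * ENNReal.ofReal (Real.exp (-t ^ 2 / (2 * σ ^ 2))) * ∑' j : ℤ, gaussWeight σ (k * j) := by
  have h := tsum_gaussWeight_multiples_gt_le σ ht hk
  rw [mul_assoc, two_mul]
  refine le_trans ?_ (add_le_add h h)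
  conv_rhs => arg 2; rw [← (Equiv.neg ℤ).tsum_eq]
  rw [← ENNReal.tsum_add]
  refine ENNReal.tsum_le_tsum fun j => ?_
  by_cases hj : t < |((k * j : ℤ) : ℝ)|
  · rw [Set.indicator_of_mem (by exact hj)]
    rcases lt_abs.1 hj with h1 | h1
    · rw [Set.indicator_of_mem (by exact h1)]
      exact le_self_add
    · have h2 : Equiv.neg ℤ j ∈ {j : ℤ | t < ((k * j : ℤ) : ℝ)} := by
        simpa using h1
      rw [Set.indicator_of_mem h2]
      simp [gaussWeight_neg]
  · rw [Set.indicator_of_notMem (by exact hj)]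
    exact zero_le

/-- The Gaussian mass of the residue class of `c` modulo `q`. -/
def classWeight (σ : ℝ) (q : ℕ) (c : ZMod q) : ℝ≥0∞ :=
  ∑' x : ℤ, {x : ℤ | (x : ZMod q) = c}.indicator (gaussWeight σ) x

/-- Each `x` of the class `c` is moved to the class `c + 1` without increasing `|x|`: negative `x`
to `x + 1 ≤ 0`, and `x ≥ q` to `x - (q - 1) > 0`. The two images are disjoint. Only the
representative in `[0, q)` is left over, and its weight is at most 1. -/
theorem classWeight_le_succ (σ : ℝ) {q : ℕ} (hq : 0 < q) (c : ZMod q) :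
    classWeight σ q c ≤ classWeight σ q (c + 1) + 1 := by
  have : NeZero q := ⟨hq.ne'⟩
  let w : ℤ → ℝ≥0∞ := gaussWeight σ
  have hneg : ∑' x : ℤ, {x : ℤ | (x : ZMod q) = c ∧ x < 0}.indicator w x ≤
      ∑' x : ℤ, {x : ℤ | (x : ZMod q) = c + 1 ∧ x ≤ 0}.indicator w x := by
    rw [← (Equiv.addRight (1 : ℤ)).tsum_eq
      ({x : ℤ | (x : ZMod q) = c + 1 ∧ x ≤ 0}.indicator w)]
    refine ENNReal.tsum_le_tsum fun x => ?_
    by_cases hx : (x : ZMod q) = c ∧ x < 0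
    · have hx' : Equiv.addRight (1 : ℤ) x ∈ {x : ℤ | (x : ZMod q) = c + 1 ∧ x ≤ 0} := by
        refine ⟨by simp [hx.1], ?_⟩
        have := hx.2
        simp only [Equiv.coe_addRight]; omega
      rw [Set.indicator_of_mem (by exact hx), Set.indicator_of_mem hx']
      refine gaussWeight_le_of_sq_le σ ?_
      have := hx.2
      simp only [Equiv.coe_addRight]; nlinarith
    · rw [Set.indicator_of_notMem (by exact hx)]; exact zero_le
  have hpos : ∑' x : ℤ, {x : ℤ | (x : ZMod q) = c ∧ q ≤ x}.indicator w x ≤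
      ∑' x : ℤ, {x : ℤ | (x : ZMod q) = c + 1 ∧ 0 < x}.indicator w x := by
    rw [← (Equiv.subRight ((q : ℤ) - 1)).tsum_eq
      ({x : ℤ | (x : ZMod q) = c + 1 ∧ 0 < x}.indicator w)]
    refine ENNReal.tsum_le_tsum fun x => ?_
    by_cases hx : (x : ZMod q) = c ∧ (q : ℤ) ≤ x
    · have hx2 := hx.2
      have hx' : Equiv.subRight ((q : ℤ) - 1) x ∈ {x : ℤ | (x : ZMod q) = c + 1 ∧ 0 < x} := by
        refine ⟨by simp [hx.1], ?_⟩
        simp only [Equiv.subRight_apply]; omega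
      rw [Set.indicator_of_mem (by exact hx), Set.indicator_of_mem hx']
      refine gaussWeight_le_of_sq_le σ ?_
      simp only [Equiv.subRight_apply]
      have hq1 : (1 : ℤ) ≤ q := by exact_mod_cast hq
      nlinarith
    · rw [Set.indicator_of_notMem (by exact hx)]; exact zero_le
  have hmid : ∑' x : ℤ, {x : ℤ | (x : ZMod q) = c ∧ 0 ≤ x ∧ x < q}.indicator w x ≤ 1 := by
    rw [tsum_eq_single (c.val : ℤ)]
    · exact (Set.indicator_le_self _ _ _).trans (gaussWeight_le_one σ _)
    · intro x hx
      refine Set.indicator_of_notMem (fun h => hx ?_) _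
      obtain ⟨h1, h2, h3⟩ := h
      rw [← h1, ZMod.val_intCast, Int.emod_eq_of_lt h2 h3]
  have hsplit : ∀ x : ℤ, {x : ℤ | (x : ZMod q) = c}.indicator w x ≤
      {x : ℤ | (x : ZMod q) = c ∧ x < 0}.indicator w x +
      {x : ℤ | (x : ZMod q) = c ∧ q ≤ x}.indicator w x +
      {x : ℤ | (x : ZMod q) = c ∧ 0 ≤ x ∧ x < q}.indicator w x := by
    intro x
    by_cases hx : (x : ZMod q) = c
    · rcases lt_or_ge x 0 with h0 | h0
      · simp [Set.indicator, hx, h0, add_assoc]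
      · rcases lt_or_ge x q with h1 | h1
        · simp [Set.indicator, hx, h0, h1]
        · simp [Set.indicator, hx, h0, h1, not_lt.2 h0, not_lt.2 h1]
    · simp [Set.indicator, hx]
  have hjoin : ∀ x : ℤ, {x : ℤ | (x : ZMod q) = c + 1 ∧ x ≤ 0}.indicator w x +
      {x : ℤ | (x : ZMod q) = c + 1 ∧ 0 < x}.indicator w x =
      {x : ℤ | (x : ZMod q) = c + 1}.indicator w x := by
    intro x
    by_cases hx : (x : ZMod q) = c + 1
    · rcases le_or_gt x 0 with h0 | h0
      · simp [Set.indicator, hx, h0, not_lt.2 h0]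
      · simp [Set.indicator, hx, h0, not_le.2 h0]
    · simp [Set.indicator, hx]
  have hle : classWeight σ q c ≤ _ := ENNReal.tsum_le_tsum hsplit
  rw [ENNReal.tsum_add, ENNReal.tsum_add] at hle
  refine (hle.trans (add_le_add (add_le_add hneg hpos) hmid)).trans (le_of_eq ?_)
  rw [← ENNReal.tsum_add, tsum_congr hjoin]
  rfl

/-- The classes `c`, `c + 1`, `c + 2` are distinct as `q > 2`, and the weight of `c` exceeds the
other two by at most 1 and 2. -/
theorem three_mul_classWeight_le (σ : ℝ) {q : ℕ} (hq : 2 < q) (c : ZMod q) :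
    3 * classWeight σ q c ≤ ∑' x, gaussWeight σ x + 3 := by
  have h1 := classWeight_le_succ σ (by omega) c
  have h2 := classWeight_le_succ σ (by omega) (c + 1)
  have h10 : (1 : ZMod q) ≠ 0 := by
    have : Fact (1 < q) := ⟨by omega⟩
    exact one_ne_zero
  have h20 : (1 : ZMod q) + 1 ≠ 0 := by
    intro h
    have h' : ((2 : ℕ) : ZMod q) = 0 := by push_cast; rw [← h]; norm_num
    rw [ZMod.natCast_eq_zero_iff] at h'
    have := Nat.le_of_dvd (by norm_num) h'
    omega
  have hsum : classWeight σ q c + classWeight σ q (c + 1) + classWeight σ q (c + 1 + 1) ≤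
      ∑' x, gaussWeight σ x := by
    rw [classWeight, classWeight, classWeight, ← ENNReal.tsum_add, ← ENNReal.tsum_add]
    refine ENNReal.tsum_le_tsum fun x => ?_
    by_cases a : (x : ZMod q) = c
    · simp [Set.indicator, a, h10, add_assoc, h20]
    · by_cases b : (x : ZMod q) = c + 1
      · simp [Set.indicator, b, h10]
      · by_cases d : (x : ZMod q) = c + 1 + 1
        · simp [Set.indicator, d, h10, add_assoc, h20]
        · simp [Set.indicator, a, b, d]
  calc 3 * classWeight σ q c = classWeight σ q c + classWeight σ q c + classWeight σ q c := by ring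
    _ ≤ classWeight σ q c + (classWeight σ q (c + 1) + 1) +
        (classWeight σ q (c + 1 + 1) + 1 + 1) := by
        gcongr
        exact h1.trans (by gcongr)
    _ = classWeight σ q c + classWeight σ q (c + 1) + classWeight σ q (c + 1 + 1) + 3 := by ring
    _ ≤ _ := by gcongr

theorem fifty_le_tsum_gaussWeight {σ : ℝ} (hσ : 100 ≤ σ) : 50 ≤ ∑' x, gaussWeight σ x := by
  have hterm : ∀ x ∈ Finset.Ico (0 : ℤ) 100, (2 : ℝ≥0∞)⁻¹ ≤ gaussWeight σ x := by
    intro x hx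
    obtain ⟨h0, h1⟩ := Finset.mem_Ico.1 hx
    have hx0 : (0 : ℝ) ≤ x := by exact_mod_cast h0
    have hx1 : (x : ℝ) ≤ 100 := by exact_mod_cast h1.le
    have : (2 : ℝ≥0∞)⁻¹ = ENNReal.ofReal (1 / 2) := by
      rw [one_div, ENNReal.ofReal_inv_of_pos (by norm_num)]; simp
    rw [this]
    refine ENNReal.ofReal_le_ofReal ?_
    have h2 : (x : ℝ) ^ 2 / (2 * σ ^ 2) ≤ 1 / 2 := by
      rw [div_le_iff₀ (by positivity)]; nlinarith
    have := Real.add_one_le_exp (-(x : ℝ) ^ 2 / (2 * σ ^ 2))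
    rw [neg_div] at this ⊢
    linarith
  calc (50 : ℝ≥0∞) = ∑ x ∈ Finset.Ico (0 : ℤ) 100, (2 : ℝ≥0∞)⁻¹ := by
        rw [Finset.sum_const, nsmul_eq_mul]
        rw [show (Finset.Ico (0 : ℤ) 100).card = 100 from rfl, ← div_eq_mul_inv, ENNReal.eq_div_iff (by norm_num) (by norm_num)]; norm_num
    _ ≤ ∑ x ∈ Finset.Ico (0 : ℤ) 100, gaussWeight σ x := Finset.sum_le_sum hterm
    _ ≤ _ := ENNReal.sum_le_tsum _

theorem toOuterMeasure_discreteGaussian {σ : ℝ} (hσ : 0 < σ) (S : Set ℤ) :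
    (discreteGaussian σ).toOuterMeasure S =
      (∑' x, S.indicator (gaussWeight σ) x) * (∑' x, gaussWeight σ x)⁻¹ := by
  rw [PMF.toOuterMeasure_apply, ← ENNReal.tsum_mul_right]
  refine tsum_congr fun x => ?_
  by_cases hx : x ∈ S
  · simp [hx, discreteGaussian, hσ, PMF.normalize_apply]
  · simp [hx]

theorem tsum_indicator_multiples (w : ℤ → ℝ≥0∞) (S : Set ℤ) {k : ℕ} (hk : 0 < k) :
    ∑' x, (S ∩ {x : ℤ | (x : ZMod k) = 0}).indicator w x =
      ∑' j : ℤ, {j : ℤ | (k * j : ℤ) ∈ S}.indicator (fun j => w (k * j)) j := by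
  have hinj : Function.Injective fun j : ℤ => (k : ℤ) * j :=
    mul_right_injective₀ (by exact_mod_cast hk.ne')
  rw [← hinj.tsum_eq]
  · refine tsum_congr fun j => ?_
    by_cases h : (k * j : ℤ) ∈ S <;> simp [Set.indicator, h]
  · intro x hx
    have := Set.mem_of_indicator_ne_zero hx
    obtain ⟨j, hj⟩ := (ZMod.intCast_zmod_eq_zero_iff_dvd x k).1 this.2
    exact ⟨j, hj.symm⟩

/-- The tail bound for the discrete Gaussian, relative to the multiples of `k`. -/
theorem toOuterMeasure_discreteGaussian_multiples_tail_le {σ : ℝ} (hσ : 0 < σ) {τ : ℝ}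
    (hτ : 0 ≤ τ) {k : ℕ} (hk : 0 < k) :
    (discreteGaussian σ).toOuterMeasure
        ({x : ℤ | τ * σ < |(x : ℝ)|} ∩ {x : ℤ | (x : ZMod k) = 0}) ≤
      2 * ENNReal.ofReal (Real.exp (-τ ^ 2 / 2)) *
        (discreteGaussian σ).toOuterMeasure {x : ℤ | (x : ZMod k) = 0} := by
  have h := tsum_gaussWeight_multiples_tail_le σ (t := τ * σ) (by positivity) hk
  have hexp : -(τ * σ) ^ 2 / (2 * σ ^ 2) = -τ ^ 2 / 2 := by field_simp
  rw [hexp] at h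
  have h1 := tsum_indicator_multiples (gaussWeight σ) {x : ℤ | τ * σ < |(x : ℝ)|} hk
  have h2 := tsum_indicator_multiples (gaussWeight σ) Set.univ hk
  simp only [Set.univ_inter, Set.mem_univ, Set.ofPred_true, Set.indicator_univ] at h2
  rw [toOuterMeasure_discreteGaussian hσ, toOuterMeasure_discreteGaussian hσ, ← mul_assoc]
  gcongr
  rw [h1, h2]
  exact h

theorem toOuterMeasure_discreteGaussian_tail_le {σ : ℝ} (hσ : 0 < σ) {τ : ℝ} (hτ : 0 ≤ τ) :
    (discreteGaussian σ).toOuterMeasure {x : ℤ | τ * σ < |(x : ℝ)|} ≤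
      2 * ENNReal.ofReal (Real.exp (-τ ^ 2 / 2)) := by
  have h := toOuterMeasure_discreteGaussian_multiples_tail_le hσ hτ one_pos
  have : {x : ℤ | (x : ZMod 1) = 0} = Set.univ := Set.eq_univ_of_forall fun x => Subsingleton.elim _ _
  rw [this, Set.inter_univ] at h
  exact h.trans (mul_le_of_le_one_right' (toOuterMeasure_le_one _ _))

/-- `53/150 = 1/3 + 1/50`, from a total weight of at least 50. The width 100 is chosen so that
`(53/150)² < 1/8`, which `residue_mass_le` needs. -/
theorem toOuterMeasure_discreteGaussian_class_le {σ : ℝ} (hσ : 100 ≤ σ) {q : ℕ} (hq : 2 < q)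
    (c : ZMod q) :
    (discreteGaussian σ).toOuterMeasure {x : ℤ | (x : ZMod q) = c} ≤
      ENNReal.ofReal (53 / 150) := by
  have hσ0 : 0 < σ := by linarith
  have h3 := three_mul_classWeight_le σ hq c
  have h50 := fifty_le_tsum_gaussWeight hσ
  have hne0 := tsum_gaussWeight_ne_zero σ
  have hnetop := tsum_gaussWeight_ne_top hσ0
  rw [toOuterMeasure_discreteGaussian hσ0, ← div_eq_mul_inv]
  refine ENNReal.div_le_of_le_mul ?_
  change classWeight σ q c ≤ _
  have hcw : classWeight σ q c ≠ ∞ := by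
    refine ne_top_of_le_ne_top hnetop ?_
    exact ENNReal.tsum_le_tsum fun x => Set.indicator_le_self _ _ _
  generalize classWeight σ q c = W at *
  generalize ∑' x, gaussWeight σ x = R at *
  lift W to NNReal using hcw
  lift R to NNReal using hnetop
  have h3' : (3 : ℝ) * W ≤ R + 3 := by exact_mod_cast h3
  have h50' : (50 : ℝ) ≤ R := by exact_mod_cast h50
  rw [← ENNReal.ofReal_coe_nnreal, ← ENNReal.ofReal_coe_nnreal,
    ← ENNReal.ofReal_mul (by norm_num)]
  exact ENNReal.ofReal_le_ofReal (by linarith)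

/-! ### Gaussian vectors -/

/-- The integer vectors with an entry larger than `t` in absolute value. -/
def tailSet (m : ℕ) (t : ℝ) : Set (Fin m → ℤ) := {x | ∃ i, t < |(x i : ℝ)|}

theorem notMem_tailSet {m : ℕ} {t : ℝ} {x : Fin m → ℤ} :
    x ∉ tailSet m t ↔ ∀ i, |(x i : ℝ)| ≤ t := by
  simp [tailSet]

/-- The tail bound `2 exp(-τ²/2)` of the discrete Gaussian. -/
def tailBound (τ : ℝ) : ℝ≥0∞ := 2 * ENNReal.ofReal (Real.exp (-τ ^ 2 / 2))

theorem toOuterMeasure_gaussVec_forall (m : ℕ) (σ : ℝ) (S : Fin m → Set ℤ) :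
    (gaussVec m σ).toOuterMeasure {x | ∀ i, x i ∈ S i} =
      ∏ i, (discreteGaussian σ).toOuterMeasure (S i) :=
  toOuterMeasure_pmfPi_forall _ S

theorem toOuterMeasure_gaussVec_tail_le (m : ℕ) {σ : ℝ} (hσ : 0 < σ) {τ : ℝ} (hτ : 0 ≤ τ) :
    (gaussVec m σ).toOuterMeasure (tailSet m (τ * σ)) ≤ m * tailBound τ := by
  have h := toOuterMeasure_pmfPi_exists_le (fun _ : Fin m => discreteGaussian σ) Finset.univ
    fun _ => {x : ℤ | τ * σ < |(x : ℝ)|}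
  simp only [Finset.mem_univ, true_and, Set.mem_ofPred_eq, Finset.sum_const, Finset.card_univ,
    Fintype.card_fin, nsmul_eq_mul] at h
  exact h.trans (by gcongr; exact toOuterMeasure_discreteGaussian_tail_le hσ hτ)

theorem toOuterMeasure_gaussVec_multiples_tail_le (m : ℕ) {σ : ℝ} (hσ : 0 < σ) {τ : ℝ}
    (hτ : 0 ≤ τ) {k : ℕ} (hk : 0 < k) :
    (gaussVec m σ).toOuterMeasure (tailSet m (τ * σ) ∩ {x | modVec k x = 0}) ≤
      m * tailBound τ * (gaussVec m σ).toOuterMeasure {x | modVec k x = 0} := by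
  classical
  let Z : Set ℤ := {x : ℤ | (x : ZMod k) = 0}
  let D : Set ℤ := {x : ℤ | τ * σ < |(x : ℝ)|}
  have hZ : {x : Fin m → ℤ | modVec k x = 0} = {x | ∀ i, x i ∈ Z} := by
    ext x; simp [modVec, funext_iff, Z]
  -- Union over the position `i` of a long entry. In each product only the `i`-th factor changes, so
  -- the bound stays relative to the mass of `kℤ^m`.
  have hU : tailSet m (τ * σ) ∩ {x | modVec k x = 0} ⊆
      ⋃ i ∈ (Finset.univ : Finset (Fin m)), {x | ∀ j, x j ∈ if j = i then D ∩ Z else Z} := by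
    rintro x ⟨⟨i, hi⟩, hx⟩
    rw [hZ] at hx
    simp only [Finset.mem_univ, Set.iUnion_true, Set.mem_iUnion]
    refine ⟨i, fun j => ?_⟩
    split_ifs with h
    · subst h; exact ⟨hi, hx j⟩
    · exact hx j
  refine (MeasureTheory.measure_mono hU).trans ((MeasureTheory.measure_biUnion_finset_le _ _).trans ?_)
  rw [hZ, mul_assoc]
  refine (Finset.sum_le_card_nsmul _ _ (tailBound τ *
    (gaussVec m σ).toOuterMeasure {x | ∀ i, x i ∈ Z}) fun i _ => ?_).trans_eq (by simp)
  rw [toOuterMeasure_gaussVec_forall, toOuterMeasure_gaussVec_forall,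
    ← Finset.mul_prod_erase _ _ (Finset.mem_univ i), ← Finset.mul_prod_erase _ (fun _ => _)
      (Finset.mem_univ i), ← mul_assoc]
  simp only [if_true]
  refine mul_le_mul' (toOuterMeasure_discreteGaussian_multiples_tail_le hσ hτ hk) ?_
  refine le_of_eq (Finset.prod_congr rfl fun j hj => ?_)
  rw [if_neg (Finset.ne_of_mem_erase hj)]

theorem gaussVec_map_modVec_le (m : ℕ) {σ : ℝ} (hσ : 100 ≤ σ) {q : ℕ} (hq : 2 < q)
    (c : Fin m → ZMod q) :
    (gaussVec m σ).map (modVec q) c ≤ ENNReal.ofReal ((53 / 150) ^ m) := by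
  rw [← PMF.toOuterMeasure_apply_singleton, PMF.toOuterMeasure_map_apply]
  have : modVec q ⁻¹' {c} = {x : Fin m → ℤ | ∀ i, x i ∈ {z : ℤ | (z : ZMod q) = c i}} := by
    ext x; simp [modVec, funext_iff]
  rw [this, toOuterMeasure_gaussVec_forall, ENNReal.ofReal_pow (by norm_num)]
  refine (Finset.prod_le_pow_card _ _ _ fun i _ =>
    toOuterMeasure_discreteGaussian_class_le hσ hq (c i)).trans_eq (by simp)

/-! ### Second moment of the mass of the solutions of a random linear system -/

theorem card_fiber_mul_card {G H : Type} [AddGroup G] [AddGroup H] [Fintype G] [Fintype H]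
    [DecidableEq H] (φ : G →+ H) (hφ : Function.Surjective φ) (y : H) :
    (Finset.univ.filter fun a => φ a = y).card * Fintype.card H = Fintype.card G := by
  have h := Finset.card_eq_sum_card_fiberwise (s := (Finset.univ : Finset G))
    (t := (Finset.univ : Finset H)) (f := φ) (by simp)
  rw [← Finset.card_univ, ← Finset.card_univ, h, mul_comm, ← smul_eq_mul, ← Finset.sum_const]
  refine Finset.sum_congr rfl fun z _ => ?_
  exact AddMonoidHom.card_fiber_eq_of_mem_range φ (hφ y) (hφ z)

/-- A left inverse of `c ↦ ∑ cᵢ vᵢ` recovers the coefficients, which are then applied to the `Yᵢ`.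
This surjectivity makes the images of independent vectors under a uniform matrix independent and
uniform. -/
theorem exists_matrix_mulVec_eq {F : Type} [Field F] {n m k : ℕ} {v : Fin k → Fin m → F} (hv : LinearIndependent F v)
    (Y : Fin k → Fin n → F) : ∃ A : Matrix (Fin n) (Fin m) F, ∀ i, A *ᵥ v i = Y i := by
  obtain ⟨g, hg⟩ := LinearMap.exists_leftInverse_of_injective (Fintype.linearCombination F v)
    (LinearMap.ker_eq_bot.2 hv.fintypeLinearCombination_injective)
  refine ⟨LinearMap.toMatrix' ((Fintype.linearCombination F Y).comp g), fun i => ?_⟩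
  rw [LinearMap.toMatrix'_mulVec, LinearMap.comp_apply]
  have : v i = Fintype.linearCombination F v (Pi.single i 1) := by simp
  rw [this, ← LinearMap.comp_apply g, hg]
  simp

section

variable {F : Type} [Field F] [Fintype F] [DecidableEq F] {n m : ℕ}

theorem card_matrix_mulVec_eq {k : ℕ} {v : Fin k → Fin m → F} (hv : LinearIndependent F v)
    (Y : Fin k → Fin n → F) :
    (Finset.univ.filter fun A : Matrix (Fin n) (Fin m) F => ∀ i, A *ᵥ v i = Y i).card *
      (Fintype.card F ^ n) ^ k = Fintype.card (Matrix (Fin n) (Fin m) F) := by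
  let φ : Matrix (Fin n) (Fin m) F →+ (Fin k → Fin n → F) :=
    { toFun := fun A i => A *ᵥ v i
      map_zero' := by ext; simp
      map_add' := fun A B => by ext; simp [Matrix.add_mulVec] }
  have h := card_fiber_mul_card φ (fun Y => by
    obtain ⟨A, hA⟩ := exists_matrix_mulVec_eq hv Y
    exact ⟨A, funext hA⟩) Y
  rw [← h]
  simp [φ, funext_iff]

theorem card_mulVec_eq {x : Fin m → F} (hx : x ≠ 0) (y : Fin n → F) :
    ((Finset.univ.filter fun A : Matrix (Fin n) (Fin m) F => A *ᵥ x = y).card : ℝ) =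
      Fintype.card (Matrix (Fin n) (Fin m) F) / (Fintype.card F : ℝ) ^ n := by
  have h := card_matrix_mulVec_eq (k := 1) (v := ![x])
    (linearIndependent_unique_iff.2 (by simpa using hx)) ![y]
  simp only [Fin.forall_fin_one, Matrix.cons_val_fin_one, pow_one] at h
  rw [eq_div_iff (by positivity)]
  exact_mod_cast h

theorem card_mulVec_eq_and {x x' : Fin m → F} (hx : x ≠ 0) (hx' : ∀ c : F, c • x ≠ x')
    (y : Fin n → F) :
    ((Finset.univ.filter fun A : Matrix (Fin n) (Fin m) F =>
      A *ᵥ x = y ∧ A *ᵥ x' = y).card : ℝ) =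
      Fintype.card (Matrix (Fin n) (Fin m) F) / ((Fintype.card F : ℝ) ^ n) ^ 2 := by
  have h := card_matrix_mulVec_eq (k := 2) (v := ![x, x'])
    ((LinearIndependent.pair_iff' hx).2 hx') ![y, y]
  simp only [Fin.forall_fin_two, Matrix.cons_val_zero, Matrix.cons_val_one] at h
  rw [eq_div_iff (by positivity)]
  exact_mod_cast h

/-- The covariance (times the number of matrices) of the events `A x = y` and `A x' = y`. -/
theorem covariance_mulVec_le {x x' : Fin m → F} (hx : x ≠ 0) (hx' : x' ≠ 0) (y : Fin n → F) :
    ∑ A : Matrix (Fin n) (Fin m) F, ((if A *ᵥ x = y then (1 : ℝ) else 0) -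
        ((Fintype.card F : ℝ) ^ n)⁻¹) * ((if A *ᵥ x' = y then (1 : ℝ) else 0) -
        ((Fintype.card F : ℝ) ^ n)⁻¹) ≤
      if ∃ c : F, c • x = x' then
        Fintype.card (Matrix (Fin n) (Fin m) F) * ((Fintype.card F : ℝ) ^ n)⁻¹ else 0 := by
  set Q : ℝ := (Fintype.card F : ℝ) ^ n with hQ
  set N : ℝ := ((Fintype.card (Matrix (Fin n) (Fin m) F) : ℕ) : ℝ) with hN
  have hQ0 : 0 < Q := by positivity
  have hN0 : 0 ≤ N := by positivity
  have e1 : ∀ z : Fin m → F, z ≠ 0 →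
      ∑ A : Matrix (Fin n) (Fin m) F, (if A *ᵥ z = y then (1 : ℝ) else 0) = N / Q := fun z hz => by
    rw [Finset.sum_boole, card_mulVec_eq hz]
  have e2 : ∑ A : Matrix (Fin n) (Fin m) F, ((if A *ᵥ x = y then (1 : ℝ) else 0) - Q⁻¹) *
      ((if A *ᵥ x' = y then (1 : ℝ) else 0) - Q⁻¹) =
      ((Finset.univ.filter fun A : Matrix (Fin n) (Fin m) F =>
        A *ᵥ x = y ∧ A *ᵥ x' = y).card : ℝ) - N / Q ^ 2 := by
    have : ∀ A : Matrix (Fin n) (Fin m) F, ((if A *ᵥ x = y then (1 : ℝ) else 0) - Q⁻¹) *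
        ((if A *ᵥ x' = y then (1 : ℝ) else 0) - Q⁻¹) =
        (if A *ᵥ x = y ∧ A *ᵥ x' = y then (1 : ℝ) else 0) -
        Q⁻¹ * (if A *ᵥ x = y then (1 : ℝ) else 0) - Q⁻¹ * (if A *ᵥ x' = y then (1 : ℝ) else 0)
        + Q⁻¹ ^ 2 := fun A => by
      by_cases h1 : A *ᵥ x = y <;> by_cases h2 : A *ᵥ x' = y <;> simp [h1, h2] <;> ring
    simp_rw [this, Finset.sum_add_distrib, Finset.sum_sub_distrib, ← Finset.mul_sum, e1 x hx,
      e1 x' hx', Finset.sum_boole, Finset.sum_const, Finset.card_univ, nsmul_eq_mul, ← hN]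
    field_simp
    ring
  rw [e2]
  -- For proportional vectors the joint event is bounded by one of the two; otherwise the events are
  -- independent and the covariance is zero.
  split_ifs with h
  · have : ((Finset.univ.filter fun A : Matrix (Fin n) (Fin m) F =>
        A *ᵥ x = y ∧ A *ᵥ x' = y).card : ℝ) ≤ N / Q := by
      rw [← card_mulVec_eq hx y]
      exact_mod_cast Finset.card_le_card fun A hA => by
        simp only [Finset.mem_filter, Finset.mem_univ, true_and] at hA ⊢
        exact hA.1
    have : 0 ≤ N / Q ^ 2 := by positivity
    rw [← div_eq_mul_inv]
    linarith
  · push Not at h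
    rw [card_mulVec_eq_and hx h, sub_self]

/-- For all but a fraction `16 |F| |F|ⁿ δ` of the matrices `A`, the solutions of `A x = y` have
mass at least `1 / (4 |F|ⁿ)`, for a distribution of min-entropy at least `-log δ`. -/
theorem card_light_matrices_le (w : (Fin m → F) → ℝ) (hw0 : ∀ x, 0 ≤ w x) {δ : ℝ}
    (hwδ : ∀ x, w x ≤ δ) (hw1 : ∑ x, w x = 1) (hδ : δ ≤ 1 / 2) (y : Fin n → F) :
    ((Finset.univ.filter fun A : Matrix (Fin n) (Fin m) F =>
        ∑ x, (if A *ᵥ x = y then w x else 0) < (4 * (Fintype.card F : ℝ) ^ n)⁻¹).card : ℝ) ≤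
      16 * Fintype.card F * (Fintype.card F : ℝ) ^ n * δ *
        Fintype.card (Matrix (Fin n) (Fin m) F) := by
  set Q : ℝ := (Fintype.card F : ℝ) ^ n with hQ
  set N : ℝ := ((Fintype.card (Matrix (Fin n) (Fin m) F) : ℕ) : ℝ) with hN
  set c : ℝ := ((Fintype.card F : ℕ) : ℝ) with hc
  have hQ0 : 0 < Q := by positivity
  have hN0 : 0 ≤ N := by positivity
  -- The zero vector is set aside because `A 0` is not random. It carries mass at most `δ ≤ 1/2`, so
  -- at least half of the mass remains.
  set X := Finset.univ.filter fun x : Fin m → F => x ≠ 0 with hX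
  have hXne : ∀ x ∈ X, x ≠ 0 := fun x hx => by simpa [hX] using hx
  set W := ∑ x ∈ X, w x with hW
  have hWge : 1 / 2 ≤ W := by
    have h := Finset.sum_filter_add_sum_filter_not Finset.univ (fun x : Fin m → F => x ≠ 0) w
    have h0 : ∑ x ∈ Finset.univ.filter (fun x : Fin m → F => ¬ x ≠ 0), w x = w 0 := by
      simp [Finset.sum_filter]
    rw [hw1, h0] at h
    have := hwδ 0
    linarith
  have hWle : W ≤ 1 := by
    rw [← hw1]
    exact Finset.sum_le_univ_sum_of_nonneg hw0
  have hδ0 : 0 ≤ δ := (hw0 0).trans (hwδ 0)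
  let f : Matrix (Fin n) (Fin m) F → ℝ := fun A =>
    ∑ x ∈ X, w x * ((if A *ᵥ x = y then (1 : ℝ) else 0) - Q⁻¹)
  -- Only proportional pairs contribute to the variance, and `x` has at most `|F|` multiples, each
  -- of mass at most `δ`.
  have hsq : ∑ A, f A ^ 2 ≤ N * Q⁻¹ * (c * δ) := by
    have h1 : ∑ A, f A ^ 2 = ∑ x ∈ X, ∑ x' ∈ X, w x * w x' *
        ∑ A : Matrix (Fin n) (Fin m) F, ((if A *ᵥ x = y then (1 : ℝ) else 0) - Q⁻¹) *
        ((if A *ᵥ x' = y then (1 : ℝ) else 0) - Q⁻¹) := by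
      simp_rw [f, sq, Finset.sum_mul_sum, Finset.mul_sum]
      rw [Finset.sum_comm]
      refine Finset.sum_congr rfl fun x _ => ?_
      rw [Finset.sum_comm]
      refine Finset.sum_congr rfl fun x' _ => Finset.sum_congr rfl fun A _ => ?_
      ring
    rw [h1]
    have h2 : ∀ x ∈ X, ∑ x' ∈ X, w x * w x' *
        ∑ A : Matrix (Fin n) (Fin m) F, ((if A *ᵥ x = y then (1 : ℝ) else 0) - Q⁻¹) *
        ((if A *ᵥ x' = y then (1 : ℝ) else 0) - Q⁻¹) ≤ w x * (N * Q⁻¹ * (c * δ)) := by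
      intro x hx
      calc _ ≤ ∑ x' ∈ X, w x * w x' * (if ∃ c : F, c • x = x' then N * Q⁻¹ else 0) := by
            refine Finset.sum_le_sum fun x' hx' => ?_
            refine mul_le_mul_of_nonneg_left ?_ (mul_nonneg (hw0 _) (hw0 _))
            exact covariance_mulVec_le (hXne x hx) (hXne x' hx') y
        _ = w x * (N * Q⁻¹ * ∑ x' ∈ X.filter (fun x' => ∃ c : F, c • x = x'), w x') := by
            rw [Finset.sum_filter (fun x' => ∃ c : F, c • x = x'), Finset.mul_sum, Finset.mul_sum]
            refine Finset.sum_congr rfl fun x' _ => ?_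
            split_ifs <;> ring
        _ ≤ _ := by
            refine mul_le_mul_of_nonneg_left (mul_le_mul_of_nonneg_left ?_ (by positivity)) (hw0 _)
            calc _ ≤ ∑ x' ∈ Finset.univ.image (fun c : F => c • x), w x' := by
                  refine Finset.sum_le_sum_of_subset_of_nonneg (fun x' hx' => ?_)
                    fun _ _ _ => hw0 _
                  simpa using (Finset.mem_filter.1 hx').2
              _ ≤ (Finset.univ.image (fun c : F => c • x)).card • δ :=
                  Finset.sum_le_card_nsmul _ _ _ fun _ _ => hwδ _
              _ ≤ c * δ := by
                  rw [nsmul_eq_mul]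
                  refine mul_le_mul_of_nonneg_right ?_ hδ0
                  rw [hc, Nat.cast_le]
                  exact Finset.card_image_le.trans_eq Finset.card_univ
    refine (Finset.sum_le_sum h2).trans ?_
    rw [← Finset.sum_mul]
    exact mul_le_of_le_one_left (by positivity) hWle
  set B := Finset.univ.filter fun A : Matrix (Fin n) (Fin m) F =>
        ∑ x, (if A *ᵥ x = y then w x else 0) < (4 * Q)⁻¹ with hB
  have hfB : ∀ A ∈ B, (4 * Q)⁻¹ ^ 2 ≤ f A ^ 2 := by
    intro A hA
    have hA' := (Finset.mem_filter.1 hA).2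
    have h1 : ∑ x ∈ X, (if A *ᵥ x = y then w x else 0) ≤
        ∑ x, (if A *ᵥ x = y then w x else 0) :=
      Finset.sum_le_univ_sum_of_nonneg fun x => by split_ifs <;> simp [hw0]
    have h2 : f A = ∑ x ∈ X, (if A *ᵥ x = y then w x else 0) - W * Q⁻¹ := by
      simp_rw [f, mul_sub, Finset.sum_sub_distrib, mul_ite, mul_one, mul_zero, hW, Finset.sum_mul]
    have h3 : (4 * Q)⁻¹ = Q⁻¹ / 4 := by rw [mul_inv]; ring
    -- As `W ≥ 1/2`, a light matrix falls short of the mean `W / Q` by at least `1/(2Q) - 1/(4Q) =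
    -- 1/(4Q)`.
    have hQi : 0 < Q⁻¹ := by positivity
    have h4 : f A ≤ -(4 * Q)⁻¹ := by
      rw [h3] at hA' ⊢
      rw [h2]
      nlinarith
    have : 0 < (4 * Q)⁻¹ := by positivity
    nlinarith
  have hcard : (B.card : ℝ) * (4 * Q)⁻¹ ^ 2 ≤ N * Q⁻¹ * (c * δ) := by
    refine le_trans ?_ hsq
    rw [← nsmul_eq_mul]
    refine (Finset.card_nsmul_le_sum _ _ _ hfB).trans ?_
    exact Finset.sum_le_univ_sum_of_nonneg fun A => sq_nonneg _
  calc (B.card : ℝ) = (B.card * (4 * Q)⁻¹ ^ 2) * (4 * Q) ^ 2 := by field_simp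
    _ ≤ (N * Q⁻¹ * (c * δ)) * (4 * Q) ^ 2 := by gcongr
    _ = _ := by field_simp; ring

end

/-! ### Conditioned Gaussians for a uniform matrix -/

/-- The vectors that are not short solutions of `A x = y`. -/
def badPreimages {n m q : ℕ} (A : Matrix (Fin n) (Fin m) (ZMod q)) (y : Fin n → ZMod q) (t : ℝ) :
    Set (Fin m → ℤ) :=
  {x | ¬ (A *ᵥ modVec q x = y ∧ x ∉ tailSet m t)}

/-- If the solutions of `A x = y` are not too light, the conditioned Gaussian is short up to
the mass of the long solutions. -/
theorem toOuterMeasure_preimageGaussian_le {n m q : ℕ} (hq : 0 < q)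
    (A : Matrix (Fin n) (Fin m) (ZMod q)) {σ : ℝ} (hσ : 0 < σ) (y : Fin n → ZMod q) {τ : ℝ}
    (hτ : 0 ≤ τ) {s : ℝ≥0∞} (hs0 : s ≠ 0)
    (hs : s ≤ (gaussVec m σ).toOuterMeasure {x | A *ᵥ modVec q x = y}) :
    (preimageGaussian A σ y).toOuterMeasure (badPreimages A y (τ * σ)) ≤
      s⁻¹ * (gaussVec m σ).toOuterMeasure
        {x | x ∈ tailSet m (τ * σ) ∧ modVec q x ≠ 0 ∧ A *ᵥ modVec q x = y} + m * tailBound τ := by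
  set p := gaussVec m σ
  set S : Set (Fin m → ℤ) := {x | A *ᵥ modVec q x = y} with hS
  have hpS : p.toOuterMeasure S ≠ 0 := fun h => hs0 (le_antisymm (h ▸ hs) zero_le)
  have hpT : p.toOuterMeasure S ≠ ∞ := ((toOuterMeasure_le_one p S).trans_lt ENNReal.one_lt_top).ne
  -- Positive mass of the solutions rules out the default point mass at `0` in `preimageGaussian`.
  have hex : ∃ x ∈ S, x ∈ p.support := by
    by_contra h
    push Not at h
    refine hpS ((PMF.toOuterMeasure_apply_eq_zero_iff p S).2 (Set.disjoint_left.2 fun x hx hxS => ?_))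
    exact h x hxS hx
  have hcond : (preimageGaussian A σ y).toOuterMeasure (badPreimages A y (τ * σ)) =
      p.toOuterMeasure (S ∩ tailSet m (τ * σ)) * (p.toOuterMeasure S)⁻¹ := by
    rw [preimageGaussian, dif_pos hex]
    simp_rw [PMF.toOuterMeasure_apply, ← ENNReal.tsum_mul_right]
    refine tsum_congr fun x => ?_
    by_cases hx : A *ᵥ modVec q x = y
    · have hx' : x ∈ S := hx
      by_cases ht : x ∈ tailSet m (τ * σ)
      · have hb : x ∈ badPreimages A y (τ * σ) := fun h => h.2 ht
        rw [Set.indicator_of_mem hb, PMF.filter_apply, Set.indicator_of_mem hx',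
          Set.indicator_of_mem (Set.mem_inter hx' ht)]
      · have hb : x ∉ badPreimages A y (τ * σ) := fun h => h ⟨hx, ht⟩
        rw [Set.indicator_of_notMem hb,
          Set.indicator_of_notMem (fun h => ht h.2 : x ∉ S ∩ tailSet m (τ * σ)), zero_mul]
    · have hx' : x ∉ S := hx
      have hb : x ∈ badPreimages A y (τ * σ) := fun h => hx h.1
      rw [Set.indicator_of_mem hb, PMF.filter_apply, Set.indicator_of_notMem hx',
        Set.indicator_of_notMem (fun h => hx' h.1 : x ∉ S ∩ tailSet m (τ * σ)), zero_mul]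
  -- For `y = 0` all of `qℤ^m` consists of solutions, so the relative tail bound applies; for `y ≠
  -- 0` no solution vanishes mod `q`.
  have hzero : p.toOuterMeasure (S ∩ (tailSet m (τ * σ) ∩ {x | modVec q x = 0})) ≤
      m * tailBound τ * p.toOuterMeasure S := by
    by_cases hy : y = 0
    · refine (MeasureTheory.measure_mono Set.inter_subset_right).trans
        ((toOuterMeasure_gaussVec_multiples_tail_le m hσ hτ hq).trans ?_)
      gcongr
      intro x hx
      have hx' : modVec q x = 0 := hx
      simp [hS, hx', hy]
    · have : S ∩ (tailSet m (τ * σ) ∩ {x | modVec q x = 0}) = ∅ := by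
        refine Set.eq_empty_of_forall_notMem fun x hx => hy ?_
        have h1 : A *ᵥ modVec q x = y := hx.1
        have h2 : modVec q x = 0 := hx.2.2
        rw [← h1, h2, Matrix.mulVec_zero]
      rw [this]
      simp
  have hsub : S ∩ tailSet m (τ * σ) ⊆
      {x | x ∈ tailSet m (τ * σ) ∧ modVec q x ≠ 0 ∧ A *ᵥ modVec q x = y} ∪
        (S ∩ (tailSet m (τ * σ) ∩ {x | modVec q x = 0})) := by
    intro x hx
    by_cases h : modVec q x = 0
    · exact Or.inr ⟨hx.1, hx.2, h⟩
    · exact Or.inl ⟨hx.2, h, hx.1⟩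
  rw [hcond]
  calc _ ≤ (p.toOuterMeasure
        {x | x ∈ tailSet m (τ * σ) ∧ modVec q x ≠ 0 ∧ A *ᵥ modVec q x = y} +
        m * tailBound τ * p.toOuterMeasure S) * (p.toOuterMeasure S)⁻¹ := by
        gcongr
        exact (MeasureTheory.measure_mono hsub).trans
          ((MeasureTheory.measure_union_le _ _).trans (by gcongr))
    _ ≤ _ := by
        rw [add_mul, mul_assoc _ _ (p.toOuterMeasure S)⁻¹, ENNReal.mul_inv_cancel hpS hpT, mul_one,
          mul_comm]
        gcongr

theorem toOuterMeasure_solutions {n m q : ℕ} [NeZero q] (A : Matrix (Fin n) (Fin m) (ZMod q))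
    (σ : ℝ) (y : Fin n → ZMod q) :
    (gaussVec m σ).toOuterMeasure {x | A *ᵥ modVec q x = y} =
      ENNReal.ofReal (∑ c, if A *ᵥ c = y then ((gaussVec m σ).map (modVec q) c).toReal else 0) := by
  have : {x : Fin m → ℤ | A *ᵥ modVec q x = y} = modVec q ⁻¹' {c | A *ᵥ c = y} := rfl
  rw [this, ← PMF.toOuterMeasure_map_apply, PMF.toOuterMeasure_apply, tsum_fintype,
    ENNReal.ofReal_sum_of_nonneg fun c _ => by split_ifs <;> simp]
  refine Finset.sum_congr rfl fun c _ => ?_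
  by_cases h : A *ᵥ c = y
  · rw [Set.indicator_of_mem (by exact h), if_pos h, ENNReal.ofReal_toReal (PMF.apply_ne_top _ _)]
  · rw [Set.indicator_of_notMem (by exact h), if_neg h, ENNReal.ofReal_zero]

theorem uniform_mulVec_eq {n m q : ℕ} [Fact q.Prime] {x : Fin m → ZMod q} (hx : x ≠ 0)
    (y : Fin n → ZMod q) :
    (PMF.uniformOfFintype (Matrix (Fin n) (Fin m) (ZMod q))).toOuterMeasure {A | A *ᵥ x = y} =
      ((q : ℝ≥0∞) ^ n)⁻¹ := by
  classical
  have h := card_matrix_mulVec_eq (k := 1) (v := ![x])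
    (linearIndependent_unique_iff.2 (by simpa using hx)) ![y]
  simp only [Fin.forall_fin_one, Matrix.cons_val_fin_one, pow_one, ZMod.card] at h
  rw [PMF.toOuterMeasure_uniformOfFintype_apply, ← h]
  have hq0 : (q : ℝ≥0∞) ^ n ≠ 0 := by simp [(Fact.out : q.Prime).ne_zero]
  have hqt : (q : ℝ≥0∞) ^ n ≠ ∞ := by simp
  have hc : Fintype.card {A : Matrix (Fin n) (Fin m) (ZMod q) // A *ᵥ x = y} =
      (Finset.univ.filter fun A : Matrix (Fin n) (Fin m) (ZMod q) => A *ᵥ x = y).card :=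
    Fintype.card_subtype _
  have hN : ((Finset.univ.filter fun A : Matrix (Fin n) (Fin m) (ZMod q) =>
      A *ᵥ x = y).card : ℝ≥0∞) ≠ 0 := by
    intro h0
    rw [Nat.cast_eq_zero] at h0
    rw [h0, zero_mul] at h
    exact Fintype.card_ne_zero h.symm
  change (Fintype.card {A : Matrix (Fin n) (Fin m) (ZMod q) // A *ᵥ x = y} : ℝ≥0∞) / _ = _
  rw [hc]
  push_cast
  rw [ENNReal.div_eq_inv_mul, ENNReal.mul_inv (Or.inl hN) (Or.inl (by simp)), mul_right_comm,
    ENNReal.inv_mul_cancel hN (by simp), one_mul]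

/-- For a uniform matrix `A`, the conditioned Gaussian is a short solution of `A x = y`. -/
theorem tsum_uniform_preimageGaussian_le {n m q : ℕ} [Fact q.Prime] (hq : 2 < q) (hm : 0 < m)
    {σ : ℝ} (hσ : 100 ≤ σ) (y : Fin n → ZMod q) {τ : ℝ} (hτ : 0 ≤ τ) :
    ∑' A, PMF.uniformOfFintype (Matrix (Fin n) (Fin m) (ZMod q)) A *
        (preimageGaussian A σ y).toOuterMeasure (badPreimages A y (τ * σ)) ≤
      ENNReal.ofReal (16 * q * q ^ n * (53 / 150) ^ m) + 5 * (m * tailBound τ) := by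
  classical
  have hσ0 : 0 < σ := by linarith
  have hqpos : 0 < q := by omega
  have hqR : (0 : ℝ) < q := by exact_mod_cast hqpos
  set U := PMF.uniformOfFintype (Matrix (Fin n) (Fin m) (ZMod q)) with hU
  set p := gaussVec m σ with hp
  set δ : ℝ := (53 / 150) ^ m with hδ
  have hδ2 : δ ≤ 1 / 2 := by
    refine (pow_le_of_le_one (by norm_num) (by norm_num) hm.ne').trans (by norm_num)
  let w : (Fin m → ZMod q) → ℝ := fun c => (p.map (modVec q) c).toReal
  have hwδ : ∀ c, w c ≤ δ := fun c =>
    ENNReal.toReal_le_of_le_ofReal (by positivity) (gaussVec_map_modVec_le m hσ hq c)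
  have hw1 : ∑ c, w c = 1 := by
    rw [← ENNReal.toReal_sum fun c _ => PMF.apply_ne_top _ _, ← tsum_fintype (L := .unconditional _),
      PMF.tsum_coe, ENNReal.toReal_one]
  have hcard := card_light_matrices_le w (fun _ => ENNReal.toReal_nonneg) hwδ hw1 hδ2 y
  rw [ZMod.card] at hcard
  set B := Finset.univ.filter fun A : Matrix (Fin n) (Fin m) (ZMod q) =>
        ∑ x, (if A *ᵥ x = y then w x else 0) < (4 * (q : ℝ) ^ n)⁻¹ with hB
  set T : Matrix (Fin n) (Fin m) (ZMod q) → Set (Fin m → ℤ) := fun A =>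
    {x | x ∈ tailSet m (τ * σ) ∧ modVec q x ≠ 0 ∧ A *ᵥ modVec q x = y} with hT
  have hQ : (4 * (q : ℝ≥0∞) ^ n) = (ENNReal.ofReal ((4 * (q : ℝ) ^ n)⁻¹))⁻¹ := by
    rw [ENNReal.ofReal_inv_of_pos (by positivity), inv_inv, ENNReal.ofReal_mul (by norm_num),
      ENNReal.ofReal_pow (by positivity)]
    simp
  -- Light matrices are charged the trivial bound 1; for the others the solutions have mass at least
  -- `s = 1/(4qⁿ)`.
  have hpt : ∀ A, (preimageGaussian A σ y).toOuterMeasure (badPreimages A y (τ * σ)) ≤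
      (B : Set (Matrix (Fin n) (Fin m) (ZMod q))).indicator 1 A +
        (4 * (q : ℝ≥0∞) ^ n * p.toOuterMeasure (T A) + m * tailBound τ) := by
    intro A
    by_cases hA : A ∈ B
    · rw [Set.indicator_of_mem (by exact_mod_cast hA)]
      exact (toOuterMeasure_le_one _ _).trans (le_add_right le_rfl)
    · rw [Set.indicator_of_notMem (by exact_mod_cast hA), zero_add, hQ]
      refine toOuterMeasure_preimageGaussian_le hqpos A hσ0 y hτ ?_ ?_
      · rw [Ne, ENNReal.ofReal_eq_zero, not_le]; positivity
      · rw [toOuterMeasure_solutions]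
        refine ENNReal.ofReal_le_ofReal ?_
        rw [hB, Finset.mem_filter, not_and, not_lt] at hA
        exact hA (Finset.mem_univ A)
  have h1 : ∑' A, U A * (B : Set (Matrix (Fin n) (Fin m) (ZMod q))).indicator 1 A ≤
      ENNReal.ofReal (16 * q * q ^ n * δ) := by
    rw [← toOuterMeasure_eq_tsum_mul, PMF.toOuterMeasure_uniformOfFintype_apply]
    refine ENNReal.div_le_of_le_mul ?_
    simp only [Finset.coe_sort_coe, Fintype.card_coe]
    rw [← ENNReal.ofReal_natCast (Fintype.card _), ← ENNReal.ofReal_mul (by positivity),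
      ← ENNReal.ofReal_natCast]
    exact ENNReal.ofReal_le_ofReal hcard
  -- Exchanging the sums, each long `x` that is nonzero mod `q` is a solution for a fraction `q⁻ⁿ`
  -- of the matrices.
  have h2 : ∑' A, U A * p.toOuterMeasure (T A) ≤ ((q : ℝ≥0∞) ^ n)⁻¹ * (m * tailBound τ) := by
    simp_rw [PMF.toOuterMeasure_apply p, ← ENNReal.tsum_mul_left]
    rw [ENNReal.tsum_comm]
    calc _ ≤ ∑' x, ((q : ℝ≥0∞) ^ n)⁻¹ * (tailSet m (τ * σ)).indicator p x := by
          refine ENNReal.tsum_le_tsum fun x => ?_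
          by_cases hx : x ∈ tailSet m (τ * σ) ∧ modVec q x ≠ 0
          · rw [Set.indicator_of_mem hx.1, ← uniform_mulVec_eq hx.2 y, PMF.toOuterMeasure_apply,
              ← ENNReal.tsum_mul_right]
            refine ENNReal.tsum_le_tsum fun A => ?_
            by_cases hA : A *ᵥ modVec q x = y
            · rw [Set.indicator_of_mem (by exact ⟨hx.1, hx.2, hA⟩), Set.indicator_of_mem (by exact hA)]
            · rw [Set.indicator_of_notMem (fun h => hA h.2.2), mul_zero]
              exact zero_le
          · refine le_of_eq_of_le (ENNReal.tsum_eq_zero.2 fun A => ?_) zero_le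
            rw [Set.indicator_of_notMem (fun h => hx ⟨h.1, h.2.1⟩), mul_zero]
      _ ≤ _ := by
          rw [ENNReal.tsum_mul_left, ← PMF.toOuterMeasure_apply]
          gcongr
          exact toOuterMeasure_gaussVec_tail_le m hσ0 hτ
  have hq0 : (q : ℝ≥0∞) ^ n ≠ 0 := by simp [hqpos.ne']
  calc _ ≤ ∑' A, (U A * (B : Set (Matrix (Fin n) (Fin m) (ZMod q))).indicator 1 A +
        (4 * (q : ℝ≥0∞) ^ n * (U A * p.toOuterMeasure (T A)) + U A * (m * tailBound τ))) := by
        refine ENNReal.tsum_le_tsum fun A => ?_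
        refine (mul_le_mul_right (hpt A) (U A)).trans_eq ?_
        ring
    _ ≤ ENNReal.ofReal (16 * q * q ^ n * δ) +
        (4 * (q : ℝ≥0∞) ^ n * (((q : ℝ≥0∞) ^ n)⁻¹ * (m * tailBound τ)) + m * tailBound τ) := by
        rw [ENNReal.tsum_add, ENNReal.tsum_add, ENNReal.tsum_mul_left, ENNReal.tsum_mul_right,
          PMF.tsum_coe, one_mul]
        gcongr
    _ = _ := by
        rw [mul_assoc 4, ← mul_assoc ((q : ℝ≥0∞) ^ n), ENNReal.mul_inv_cancel hq0 (by simp)]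
        ring

/-! ### The gadget matrix and dot products -/

theorem sum_testBit_two_pow {R : Type} [CommRing R] (x k : ℕ) :
    ∑ j : Fin k, (2 : R) ^ (j : ℕ) * (if x.testBit j then 1 else 0) = ((x % 2 ^ k : ℕ) : R) := by
  induction k with
  | zero => simp [Nat.mod_one]
  | succ k ih =>
    rw [Fin.sum_univ_castSucc, Nat.mod_pow_succ]
    simp only [Fin.val_castSucc, Fin.val_last, ih]
    rcases Nat.mod_two_eq_zero_or_one (x / 2 ^ k) with h | h <;>
      simp [Nat.testBit_eq_decide_div_mod_eq, h]

theorem gadget_mulVec_gadgetInv {n q : ℕ} [NeZero q] (v : Fin n → ZMod q) :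
    gadget n q *ᵥ gadgetInv v = v := by
  ext i
  rw [Matrix.mulVec, dotProduct, ← finProdFinEquiv.sum_comp, Fintype.sum_prod_type]
  simp only [gadget, gadgetInv, Equiv.symm_apply_apply]
  rw [Finset.sum_eq_single i]
  · simp only [if_true]
    rw [sum_testBit_two_pow, Nat.mod_eq_of_lt, ZMod.natCast_zmod_val]
    exact (ZMod.val_lt _).trans_le (Nat.le_pow_clog one_lt_two q)
  · intro j _ hj
    simp [hj]
  · simp

/-- The binary expansion as an integer vector. -/
def gadgetInvInt {n q : ℕ} (v : Fin n → ZMod q) : Fin (gadgetLen n q) → ℤ :=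
  fun c => if (v (finProdFinEquiv.symm c).1).val.testBit (finProdFinEquiv.symm c).2 then 1 else 0

theorem modVec_gadgetInvInt {n q : ℕ} (v : Fin n → ZMod q) :
    modVec q (gadgetInvInt v) = gadgetInv v := by
  ext c
  simp only [modVec, gadgetInvInt, gadgetInv]
  split_ifs <;> simp

theorem abs_gadgetInvInt_le {n q : ℕ} (v : Fin n → ZMod q) (c : Fin (gadgetLen n q)) :
    |(gadgetInvInt v c : ℝ)| ≤ 1 := by
  simp only [gadgetInvInt]
  split_ifs <;> simp

theorem modVec_dotProduct_modVec {m q : ℕ} (x y : Fin m → ℤ) :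
    modVec q x ⬝ᵥ modVec q y = ((x ⬝ᵥ y : ℤ) : ZMod q) := by
  simp [dotProduct, modVec]

theorem abs_dotProduct_le {m : ℕ} {x y : Fin m → ℤ} {a b : ℝ} (hx : ∀ i, |(x i : ℝ)| ≤ a)
    (hy : ∀ i, |(y i : ℝ)| ≤ b) : |((x ⬝ᵥ y : ℤ) : ℝ)| ≤ m * (a * b) := by
  have : ((x ⬝ᵥ y : ℤ) : ℝ) = ∑ i, (x i : ℝ) * (y i : ℝ) := by simp [dotProduct]
  rw [this]
  refine (Finset.abs_sum_le_sum_abs _ _).trans ?_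
  refine (Finset.sum_le_card_nsmul _ _ (a * b) fun i _ => ?_).trans_eq (by simp)
  rw [abs_mul]
  exact mul_le_mul (hx i) (hy i) (abs_nonneg _) ((abs_nonneg _).trans (hx i))

/-! ### Decryption of well-formed ciphertexts with short noise -/

/-- By `hk`, `s_aᵀ M_a k_a` equals the contribution of `s_a` to the other two products, and `G
G⁻¹(v) = v` leaves `u·v`. The error is computed over `ℤ`, with an integer lift `r` of the oracle
value, so that its size makes sense. -/
theorem decryption_identity {n m' q : ℕ} [NeZero q] {ι : Type} [Fintype ι]
    (M : ι → Matrix (Fin n) (Fin (gadgetLen n q)) (ZMod q))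
    (B : ι → Matrix (Fin n) (Fin m') (ZMod q))
    (P : ι → Matrix (Fin n) (Fin (gadgetLen n q)) (ZMod q))
    (u v : Fin n → ZMod q) (s : ι → Fin n → ZMod q) (r : Fin m' → ℤ)
    (k e₁ : ι → Fin (gadgetLen n q) → ℤ) (e₂ : Fin m' → ℤ) (e₃ : Fin (gadgetLen n q) → ℤ)
    (hk : ∀ a, M a *ᵥ modVec q (k a) = P a *ᵥ gadgetInv v + B a *ᵥ modVec q r) :
    ((∑ a, s a ᵥ* P a) + modVec q e₃ + u ᵥ* gadget n q) ⬝ᵥ gadgetInv v +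
      ((∑ a, s a ᵥ* B a) + modVec q e₂) ⬝ᵥ modVec q r -
      ∑ a, (s a ᵥ* M a + modVec q (e₁ a)) ⬝ᵥ modVec q (k a) =
    u ⬝ᵥ v + ((e₃ ⬝ᵥ gadgetInvInt v + e₂ ⬝ᵥ r - ∑ a, e₁ a ⬝ᵥ k a : ℤ) : ZMod q) := by
  have h1 : ∀ a, (s a ᵥ* M a + modVec q (e₁ a)) ⬝ᵥ modVec q (k a) =
      (s a ᵥ* P a) ⬝ᵥ gadgetInv v + (s a ᵥ* B a) ⬝ᵥ modVec q r + ((e₁ a ⬝ᵥ k a : ℤ) : ZMod q) := by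
    intro a
    rw [add_dotProduct, ← Matrix.dotProduct_mulVec, hk, dotProduct_add, Matrix.dotProduct_mulVec,
      Matrix.dotProduct_mulVec, modVec_dotProduct_modVec]
  simp_rw [h1, Finset.sum_add_distrib, add_dotProduct, sum_dotProduct]
  rw [← Matrix.dotProduct_mulVec u, gadget_mulVec_gadgetInv]
  push_cast
  rw [← modVec_gadgetInvInt v, modVec_dotProduct_modVec, modVec_dotProduct_modVec]
  ring

theorem abs_noise_le {l n q m' L : ℕ} {χ χ' : ℝ} (hχ : 0 < χ) {ι : Type} [Fintype ι]
    (hL : Fintype.card ι ≤ L) (v : Fin n → ZMod q) {r : Fin m' → ℤ}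
    {k e₁ : ι → Fin (gadgetLen n q) → ℤ} {e₂ : Fin m' → ℤ} {e₃ : Fin (gadgetLen n q) → ℤ}
    (hr : r ∉ tailSet m' (√(l : ℝ) * χ')) (hk : ∀ a, k a ∉ tailSet _ (√(l : ℝ) * χ))
    (h₁ : ∀ a, e₁ a ∉ tailSet _ (√(l : ℝ) * χ)) (h₂ : e₂ ∉ tailSet m' (√(l : ℝ) * χ))
    (h₃ : e₃ ∉ tailSet _ (√(l : ℝ) * χ)) :
    |((e₃ ⬝ᵥ gadgetInvInt v + e₂ ⬝ᵥ r - ∑ a, e₁ a ⬝ᵥ k a : ℤ) : ℝ)| ≤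
      noiseBound l n q m' L χ χ' := by
  simp only [notMem_tailSet] at hr hk h₁ h₂ h₃
  have hl : √(l : ℝ) * √(l : ℝ) = l := Real.mul_self_sqrt (Nat.cast_nonneg l)
  have b3 := abs_dotProduct_le h₃ (abs_gadgetInvInt_le v)
  have b2 := abs_dotProduct_le h₂ hr
  have b1 : |((∑ a, e₁ a ⬝ᵥ k a : ℤ) : ℝ)| ≤ L * (gadgetLen n q * (l * χ ^ 2)) := by
    rw [Int.cast_sum]
    refine (Finset.abs_sum_le_sum_abs _ _).trans ?_
    refine (Finset.sum_le_card_nsmul _ _ _ fun a _ => abs_dotProduct_le (h₁ a) (hk a)).trans ?_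
    rw [nsmul_eq_mul, Finset.card_univ]
    have : √(l : ℝ) * χ * (√(l : ℝ) * χ) = l * χ ^ 2 := by
      linear_combination χ ^ 2 * hl
    rw [this]
    gcongr
  have e2 : (m' : ℝ) * (√(l : ℝ) * χ * (√(l : ℝ) * χ')) = l * χ * χ' * m' := by
    linear_combination m' * χ * χ' * hl
  rw [e2] at b2
  rw [Int.cast_sub, Int.cast_add]
  refine (abs_sub _ _).trans ((add_le_add ((abs_add_le _ _).trans (add_le_add b3 b2)) b1).trans ?_)
  rw [noiseBound]
  apply le_of_eq
  ring

/-! ### Key generation -/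

theorem tsum_mul_tsum_mul_comm {α β : Type} (p : α → ℝ≥0∞) (r : β → ℝ≥0∞) (F : α → β → ℝ≥0∞) :
    ∑' a, p a * ∑' b, r b * F a b = ∑' b, r b * ∑' a, p a * F a b := by
  simp_rw [← ENNReal.tsum_mul_left]
  rw [ENNReal.tsum_comm]
  simp_rw [mul_left_comm]

/-- The bound on the probability that a secret key is not a short preimage. -/
def keyError (n q : ℕ) (τ : ℝ) : ℝ≥0∞ :=
  ENNReal.ofReal (16 * q * q ^ n * (53 / 150) ^ gadgetLen n q) +
    5 * (gadgetLen n q * tailBound τ) + 2 * ENNReal.ofReal (2 * (2 ^ n)⁻¹)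

theorem gadgetLen_pos {n q : ℕ} (hn : 0 < n) (hq : 2 < q) : 0 < gadgetLen n q :=
  Nat.mul_pos hn (Nat.clog_pos one_lt_two (by omega))

theorem TrapdoorAlgorithms.IsTrapdoor.tsum_samplePre_le {T : TrapdoorAlgorithms}
    {χ₀ : ℕ → ℕ → ℝ} (hT : T.IsTrapdoor χ₀) {n q : ℕ} [Fact q.Prime] (hn : 0 < n) (hq : 2 < q)
    {σ : ℝ} (hσ : 100 ≤ σ) (hχ₀ : χ₀ n q ≤ σ) {τ : ℝ} (hτ : 0 ≤ τ) (y : Fin n → ZMod q) :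
    ∑' At, T.trapGen n (gadgetLen n q) q At *
      (T.samplePre At.1 At.2 y σ).toOuterMeasure (badPreimages At.1 y (τ * σ)) ≤
        keyError n q τ := by
  obtain ⟨h1, h2⟩ := hT n q hn hq
  let G := T.trapGen n (gadgetLen n q) q
  let h : (Matrix (Fin n) (Fin (gadgetLen n q)) (ZMod q) × T.Td n (gadgetLen n q) q) ×
      (Fin (gadgetLen n q) → ℤ) → ℝ≥0∞ := fun z =>
    (badPreimages z.1.1 y (τ * σ)).indicator 1 z.2
  have hh : ∀ z, h z ≤ 1 := fun z => by
    by_cases hz : z.2 ∈ badPreimages z.1.1 y (τ * σ) <;> simp [h, hz]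
  -- First exchange: `SamplePre` against the conditioned Gaussian. The test function reads only `A`
  -- and the preimage, so the trapdoor can then be dropped and `A` made uniform in `h4`.
  have h3 := tsum_mul_le_add_statDist _ _ hh (h2 σ (by linarith) hχ₀ y)
  simp_rw [tsum_bind_mul, tsum_map_mul, h, ← toOuterMeasure_eq_tsum_mul] at h3
  have h4 := tsum_mul_le_add_statDist _ _ (h := fun A =>
    (preimageGaussian A σ y).toOuterMeasure (badPreimages A y (τ * σ)))
    (fun A => toOuterMeasure_le_one _ _) h1
  rw [tsum_map_mul] at h4
  refine h3.trans ((add_le_add_left (h4.trans (add_le_add_left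
    (tsum_uniform_preimageGaussian_le hq (gadgetLen_pos hn hq) hσ y hτ) _)) _).trans_eq ?_)
  rw [keyError, add_assoc, ← two_mul]

/-- The distribution of the keys of an authority. -/
def authKeys (T : TrapdoorAlgorithms) (n q m' : ℕ) [NeZero q] :
    PMF (PublicKey n q m' × T.Td n (gadgetLen n q) q) :=
  (T.trapGen n (gadgetLen n q) q).bind fun At =>
  (PMF.uniformOfFintype (Matrix (Fin n) (Fin m') (ZMod q))).bind fun B =>
  (PMF.uniformOfFintype (Matrix (Fin n) (Fin (gadgetLen n q)) (ZMod q))).bind fun P =>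
  PMF.pure ((At.1, B, P), At.2)

/-- The vector `P G⁻¹(v) + B r` of which the secret keys are preimages. -/
def keyTarget {n q m' : ℕ} (pk : PublicKey n q m') (v : Fin n → ZMod q) (r : Fin m' → ZMod q) :
    Fin n → ZMod q :=
  pk.2.2 *ᵥ gadgetInv v + pk.2.1 *ᵥ r

/-- `B` and `P` are independent of `(A, td)`, so they can be fixed beforehand; the target is then a
constant, as the trapdoor property requires. -/
theorem tsum_authKeys_samplePre_le {T : TrapdoorAlgorithms} {χ₀ : ℕ → ℕ → ℝ}
    (hT : T.IsTrapdoor χ₀) {n q m' : ℕ} [Fact q.Prime] (hn : 0 < n) (hq : 2 < q)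
    {χ : ℝ} (hχ : 100 ≤ χ) (hχ₀ : χ₀ n q ≤ χ) {τ : ℝ} (hτ : 0 ≤ τ)
    (r : Fin m' → ZMod q) (v : Fin n → ZMod q) :
    ∑' key, authKeys T n q m' key *
      (T.samplePre key.1.1 key.2 (keyTarget key.1 v r) χ).toOuterMeasure
        (badPreimages key.1.1 (keyTarget key.1 v r) (τ * χ)) ≤
      keyError n q τ := by
  have h := fun y => hT.tsum_samplePre_le hn hq hχ hχ₀ hτ y
  generalize keyError n q τ = η at h ⊢
  let F : Matrix (Fin n) (Fin (gadgetLen n q)) (ZMod q) × T.Td n (gadgetLen n q) q →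
      (Fin n → ZMod q) → ℝ≥0∞ := fun At y =>
    (T.samplePre At.1 At.2 y χ).toOuterMeasure (badPreimages At.1 y (τ * χ))
  change ∑' key, authKeys T n q m' key * F (key.1.1, key.2) (keyTarget key.1 v r) ≤ η
  change ∀ y, ∑' At, T.trapGen n (gadgetLen n q) q At * F At y ≤ η at h
  generalize F = F at h ⊢
  rw [authKeys, tsum_bind_mul]
  simp_rw [tsum_bind_mul, tsum_pure_mul]
  rw [tsum_mul_tsum_mul_comm]
  refine tsum_mul_le_of_le _ fun B => ?_
  rw [tsum_mul_tsum_mul_comm]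
  exact tsum_mul_le_of_le _ fun P => h (P *ᵥ gadgetInv v + B *ᵥ r)

/-! ### The failure probability of decryption -/

theorem randomOracle_tail_le {l n q m' : ℕ} [NeZero q] {χ' : ℝ} (hχ' : 0 < χ') {τ : ℝ}
    (hτ : 0 ≤ τ) (z : BitString l × (Fin n → ZMod q)) :
    (randomOracle l n q m' χ').toOuterMeasure
      {H | ¬ ∃ r : Fin m' → ℤ, r ∉ tailSet m' (τ * χ') ∧ modVec q r = H z} ≤ m' * tailBound τ := by
  refine (toOuterMeasure_pmfPi_coord (fun _ => (gaussVec m' χ').map (modVec q)) z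
    {h | ¬ ∃ r : Fin m' → ℤ, r ∉ tailSet m' (τ * χ') ∧ modVec q r = h}).trans_le ?_
  rw [PMF.toOuterMeasure_map_apply]
  refine (MeasureTheory.measure_mono fun r hr => ?_).trans
    (toOuterMeasure_gaussVec_tail_le m' hχ' hτ)
  by_contra hr'
  exact hr ⟨r, hr', rfl⟩

/-- The distribution of the value obtained by encrypting `u` and decrypting with the keys `k`. -/
def encDec {n q m' : ℕ} [NeZero q] (χ : ℝ) {ι : Type} [Fintype ι] (u v : Fin n → ZMod q)
    (r : Fin m' → ZMod q) (pk : ι → PublicKey n q m') (k : ι → Fin (gadgetLen n q) → ℤ) :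
    PMF (Option (ZMod q)) :=
  (pmfPi fun _ : ι => PMF.uniformOfFintype (Fin n → ZMod q)).bind fun s =>
  (pmfPi fun _ : ι => gaussVec (gadgetLen n q) χ).bind fun e₁ =>
  (gaussVec m' χ).bind fun e₂ =>
  (gaussVec (gadgetLen n q) χ).bind fun e₃ =>
  PMF.pure <| some
    (((∑ a, s a ᵥ* (pk a).2.2) + modVec q e₃ + u ᵥ* gadget n q) ⬝ᵥ gadgetInv v +
      ((∑ a, s a ᵥ* (pk a).2.1) + modVec q e₂) ⬝ᵥ r -
      ∑ a, (s a ᵥ* (pk a).1 + modVec q (e₁ a)) ⬝ᵥ modVec q (k a))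

theorem evIPFE_decryption (T : TrapdoorAlgorithms) (l n q m' : ℕ) [NeZero q] (χ χ' : ℝ)
    (u v : Fin n → ZMod q) (gid : BitString l) (A A' : Finset (BitString l)) (hA : A ⊆ A') :
    (evIPFE T l n q m' χ χ').decryption u v gid A A' hA =
      (randomOracle l n q m' χ').bind fun H =>
      (pmfPi fun _ : A' => authKeys T n q m').bind fun keys =>
      (pmfPi fun a : A' => T.samplePre (keys a).1.1 (keys a).2
        (keyTarget (keys a).1 v (H (gid, v))) χ).bind fun k =>
      encDec χ u v (H (gid, v)) (fun a : A => (keys ⟨a, hA a.2⟩).1)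
        fun a => k ⟨a, hA a.2⟩ := by
  refine congrArg (PMF.bind (randomOracle l n q m' χ')) (funext fun H => ?_)
  refine congrArg (PMF.bind (pmfPi fun _ : A' => authKeys T n q m')) (funext fun keys => ?_)
  refine congrArg (PMF.bind (pmfPi fun a : A' => T.samplePre (keys a).1.1 (keys a).2
        (keyTarget (keys a).1 v (H (gid, v))) χ)) (funext fun k => ?_)
  refine (PMF.bind_bind _ _ _).trans (congrArg (PMF.bind _) (funext fun s => ?_))
  refine (PMF.bind_bind _ _ _).trans (congrArg (PMF.bind _) (funext fun e₁ => ?_))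
  refine (PMF.bind_bind _ _ _).trans (congrArg (PMF.bind _) (funext fun e₂ => ?_))
  refine (PMF.bind_bind _ _ _).trans (congrArg (PMF.bind _) (funext fun e₃ => ?_))
  refine (PMF.pure_bind _ _).trans (congrArg PMF.pure ?_)
  exact dif_pos hA

theorem encDec_failure_le {l n q m' L : ℕ} [NeZero q] {χ χ' : ℝ} (hχ : 0 < χ)
    {ι : Type} [Fintype ι] (hL : Fintype.card ι ≤ L) (u v : Fin n → ZMod q)
    (pk : ι → PublicKey n q m') (k : ι → Fin (gadgetLen n q) → ℤ)
    {r : Fin m' → ℤ} (hr : r ∉ tailSet m' (√(l : ℝ) * χ'))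
    (hk : ∀ a, k a ∉ badPreimages (pk a).1 (keyTarget (pk a) v (modVec q r)) (√(l : ℝ) * χ)) :
    (encDec χ u v (modVec q r) pk k).toOuterMeasure
        (approxEvent (u ⬝ᵥ v) (noiseBound l n q m' L χ χ'))ᶜ ≤
      Fintype.card ι * (gadgetLen n q * tailBound √(l : ℝ)) +
        (m' * tailBound √(l : ℝ) + gadgetLen n q * tailBound √(l : ℝ)) := by
  have hτ := Real.sqrt_nonneg (l : ℝ)
  have tail : ∀ m : ℕ, (gaussVec m χ).toOuterMeasure (tailSet m (√(l : ℝ) * χ)) ≤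
      m * tailBound √(l : ℝ) := fun m => toOuterMeasure_gaussVec_tail_le m hχ hτ
  rw [encDec]
  -- No secret is bad: the `s_a` cancel whatever their values.
  refine (toOuterMeasure_bind_le_add _ _ _ ∅ _ fun s _ => ?_).trans_eq
    (by rw [MeasureTheory.measure_empty, zero_add])
  have h₁ := toOuterMeasure_pmfPi_exists_le (fun _ : ι => gaussVec (gadgetLen n q) χ) Finset.univ
    fun _ => tailSet _ (√(l : ℝ) * χ)
  refine (toOuterMeasure_bind_le_add _ _ _ _ _ fun e₁ he₁ => ?_).trans
    (add_le_add_left (h₁.trans ((Finset.sum_le_card_nsmul _ _ _ fun a _ => tail _).trans_eq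
      (by rw [nsmul_eq_mul, Finset.card_univ]))) _)
  refine (toOuterMeasure_bind_le_add _ _ _ (tailSet _ (√(l : ℝ) * χ)) _ fun e₂ he₂ => ?_).trans
    (add_le_add_left (tail _) _)
  refine (toOuterMeasure_bind_le_add _ _ _ (tailSet _ (√(l : ℝ) * χ)) 0 fun e₃ he₃ => ?_).trans
    ((add_le_add_left (tail _) _).trans_eq (add_zero _))
  rw [PMF.toOuterMeasure_pure_apply, if_neg]
  rw [Set.notMem_compl_iff]
  have hk' : ∀ a, (pk a).1 *ᵥ modVec q (k a) = keyTarget (pk a) v (modVec q r) ∧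
      k a ∉ tailSet _ (√(l : ℝ) * χ) := fun a => not_not.1 (hk a)
  refine ⟨e₃ ⬝ᵥ gadgetInvInt v + e₂ ⬝ᵥ r - ∑ a, e₁ a ⬝ᵥ k a, ?_, ?_⟩
  · refine abs_noise_le hχ hL v hr (fun a => (hk' a).2) (fun a ha => ?_) he₂ he₃
    exact he₁ ⟨a, Finset.mem_univ a, ha⟩
  · exact congrArg some (decryption_identity _ _ _ u v s r k e₁ e₂ e₃ fun a => (hk' a).1)

theorem decryption_failure_le {T : TrapdoorAlgorithms} {χ₀ : ℕ → ℕ → ℝ}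
    (hT : T.IsTrapdoor χ₀) {l n q m' L : ℕ} [Fact q.Prime] (hn : 0 < n) (hq : 2 < q)
    {χ χ' : ℝ} (hχ : 100 ≤ χ) (hχ' : 0 < χ') (hχ₀ : χ₀ n q ≤ χ) (u v : Fin n → ZMod q)
    (gid : BitString l) (A A' : Finset (BitString l)) (hA : A ⊆ A') (hL : A.card ≤ L) :
    ((evIPFE T l n q m' χ χ').decryption u v gid A A' hA).toOuterMeasure
        (approxEvent (u ⬝ᵥ v) (noiseBound l n q m' L χ χ'))ᶜ ≤
      m' * tailBound √(l : ℝ) + (A.card * keyError n q √(l : ℝ) +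
        (A.card * (gadgetLen n q * tailBound √(l : ℝ)) +
          (m' * tailBound √(l : ℝ) + gadgetLen n q * tailBound √(l : ℝ)))) := by
  have hτ := Real.sqrt_nonneg (l : ℝ)
  have hχ0 : 0 < χ := by linarith
  have hkey := fun r => tsum_authKeys_samplePre_le hT (m' := m') hn hq hχ hχ₀ hτ r v
  generalize keyError n q √(l : ℝ) = η at hkey ⊢
  rw [evIPFE_decryption]
  refine (toOuterMeasure_bind_le_add _ _ _ {H | ¬ ∃ r : Fin m' → ℤ,
    r ∉ tailSet m' (√(l : ℝ) * χ') ∧ modVec q r = H (gid, v)} _ fun H hH => ?_).trans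
    (add_le_add_left (randomOracle_tail_le hχ' hτ (gid, v)) _)
  obtain ⟨r, hr, hrH⟩ := not_not.1 hH
  rw [← hrH]
  let emb : A ↪ A' := Subtype.impEmbedding (· ∈ A) (· ∈ A') hA
  -- Only the keys of the authorities in `A` enter decryption, so only these have to be good.
  let s : Finset A' := Finset.univ.map emb
  have hs : s.card = A.card := by simp [s]
  let bad : PublicKey n q m' → Set (Fin (gadgetLen n q) → ℤ) := fun pk =>
    badPreimages pk.1 (keyTarget pk v (modVec q r)) (√(l : ℝ) * χ)
  let p : PublicKey n q m' × T.Td n (gadgetLen n q) q → ℝ≥0∞ := fun key =>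
    (T.samplePre key.1.1 key.2 (keyTarget key.1 v (modVec q r)) χ).toOuterMeasure (bad key.1)
  refine (toOuterMeasure_bind_le _ _ _ (fun keys => ∑ a ∈ s, p (keys a)) _ fun keys => ?_).trans
    (add_le_add_left ?_ _)
  · have hex := toOuterMeasure_pmfPi_exists_le (fun a : A' => T.samplePre (keys a).1.1 (keys a).2
      (keyTarget (keys a).1 v (modVec q r)) χ) s fun a => bad (keys a).1
    refine le_trans (toOuterMeasure_bind_le_add _ _ _ _ _ fun k hk => ?_) (add_le_add_left hex _)
    have hL' : Fintype.card A ≤ L := by rwa [Fintype.card_coe]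
    have h := encDec_failure_le (l := l) (χ' := χ') hχ0 hL' u v (fun a : A => (keys (emb a)).1)
      (fun a => k (emb a)) hr fun a ha =>
        hk ⟨emb a, Finset.mem_map_of_mem emb (Finset.mem_univ a), ha⟩
    rw [Fintype.card_coe] at h
    exact h
  · simp_rw [Finset.mul_sum]
    rw [Summable.tsum_finsetSum fun _ _ => ENNReal.summable]
    refine (Finset.sum_le_card_nsmul _ _ η fun a _ => ?_).trans_eq
      (by rw [hs, nsmul_eq_mul])
    rw [tsum_pmfPi_mul (fun _ : A' => authKeys T n q m') a p]
    exact hkey _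

/-! ### Negligible functions -/

theorem IsPolyBounded.mul_negligible {p : ℕ → ℕ} {f : ℕ → ℝ} (hp : IsPolyBounded p)
    (hf : IsNegligible f) : IsNegligible fun l => p l * f l := by
  obtain ⟨c, hc⟩ := hp
  intro k
  have h := (hc.mul (Asymptotics.isBigO_refl (fun l : ℕ => (l : ℝ) ^ k * f l) Filter.atTop))
  refine (h.congr' ?_ ?_).trans_tendsto (hf (c + k))
  · exact Filter.Eventually.of_forall fun l => by ring
  · exact Filter.Eventually.of_forall fun l => by simp only []; ring

theorem IsNegligible.sqrt {f : ℕ → ℝ} (hf : IsNegligible f) : IsNegligible fun l => √(f l) := by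
  intro k
  have h := (hf (k * 2)).sqrt
  rw [Real.sqrt_zero] at h
  refine h.congr fun l => ?_
  rw [pow_mul, Real.sqrt_mul (sq_nonneg _), Real.sqrt_sq (by positivity)]

theorem isNegligible_exp_neg_half : IsNegligible fun l : ℕ => Real.exp (-(l : ℝ) / 2) := by
  intro k
  have h := ((Real.tendsto_pow_mul_exp_neg_atTop_nhds_zero k).comp
    ((tendsto_natCast_atTop_atTop (R := ℝ)).atTop_div_const (two_pos))).const_mul ((2 : ℝ) ^ k)
  rw [mul_zero] at h
  refine h.congr fun l => ?_
  simp only [Function.comp_apply]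
  rw [← mul_assoc, ← mul_pow, neg_div]
  congr 2
  field_simp

theorem IsNegligible.tendsto_of_two_pow_inv {n : ℕ → ℕ}
    (hn : IsNegligible fun l => ((2 : ℝ) ^ n l)⁻¹) : Filter.Tendsto n Filter.atTop Filter.atTop := by
  refine Filter.tendsto_atTop.2 fun K => ?_
  have h := hn 0
  simp only [pow_zero, one_mul] at h
  filter_upwards [h.eventually_lt_const (show (0 : ℝ) < (2 ^ K)⁻¹ by positivity)] with l hl
  rw [inv_lt_inv₀ (by positivity) (by positivity)] at hl
  exact ((pow_lt_pow_iff_right₀ (one_lt_two : (1 : ℝ) < 2)).1 hl).le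

/-! ### Parameters -/

/-- Since `(53/150)² ≤ 2⁻³` and `2^⌈log q⌉ ≥ q`, the left side is at most `16 q^(1 - n/2)`. For `n ≥
2` the exponent is not positive and `q` may be replaced by 2. The estimate is made on squares to
avoid half-integer powers. -/
theorem residue_mass_le {n q : ℕ} (hn : 2 ≤ n) (hq : 2 < q) :
    16 * (q : ℝ) * (q : ℝ) ^ n * (53 / 150) ^ gadgetLen n q ≤ 32 * √((2 : ℝ) ^ n)⁻¹ := by
  have hq2 : (2 : ℝ) ≤ q := by exact_mod_cast hq.le
  have hq0 : (0 : ℝ) < q := by linarith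
  have hr : ((53 / 150 : ℝ) ^ gadgetLen n q) ^ 2 ≤ ((q : ℝ) ^ (3 * n))⁻¹ := by
    have hclog : (q : ℝ) ≤ 2 ^ Nat.clog 2 q := by exact_mod_cast Nat.le_pow_clog one_lt_two q
    calc ((53 / 150 : ℝ) ^ gadgetLen n q) ^ 2 = ((53 / 150 : ℝ) ^ 2) ^ gadgetLen n q := by
          rw [← pow_mul, ← pow_mul, mul_comm]
      _ ≤ ((2 ^ 3 : ℝ)⁻¹) ^ gadgetLen n q := by gcongr; norm_num
      _ = (((2 : ℝ) ^ Nat.clog 2 q) ^ (3 * n))⁻¹ := by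
          rw [inv_pow, ← pow_mul, ← pow_mul]; congr 2; rw [gadgetLen]; ring
      _ ≤ _ := by gcongr
  have hsq : ((q : ℝ) * q ^ n * (53 / 150) ^ gadgetLen n q) ^ 2 ≤ 2 ^ 2 * ((2 : ℝ) ^ n)⁻¹ := by
    obtain ⟨k, rfl⟩ := Nat.exists_eq_add_of_le hn
    calc _ = ((q : ℝ) * q ^ (2 + k)) ^ 2 * ((53 / 150) ^ gadgetLen (2 + k) q) ^ 2 := mul_pow _ _ _
      _ ≤ ((q : ℝ) * q ^ (2 + k)) ^ 2 * ((q : ℝ) ^ (3 * (2 + k)))⁻¹ := by gcongr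
      _ = ((q : ℝ) ^ k)⁻¹ := by field_simp; ring
      _ ≤ ((2 : ℝ) ^ k)⁻¹ := by gcongr
      _ = _ := by rw [pow_add]; field_simp
  have h := Real.le_sqrt_of_sq_le hsq
  rw [Real.sqrt_mul (by norm_num), Real.sqrt_sq (by norm_num)] at h
  linarith

/-- Both logarithms are at least 1, so `g` alone pushes the threshold above `C`, uniformly in the
modulus. -/
theorem eventually_le_of_threshold {χ₀ : ℕ → ℕ → ℝ} {g : ℕ → ℝ}
    (hg : Filter.Tendsto (fun k : ℕ => g k / √(Real.logb 2 k)) Filter.atTop Filter.atTop)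
    (hχ₀ : ∀ k p : ℕ, χ₀ k p = √(k * Real.logb 2 p) * g k) {C : ℝ} (hC : 0 ≤ C) :
    ∀ᶠ k in Filter.atTop, ∀ p, 2 < p → C ≤ χ₀ k p := by
  filter_upwards [hg.eventually_ge_atTop C, Filter.eventually_ge_atTop 2] with k hk hk2 p hp
  have one_le : ∀ j : ℕ, 2 ≤ j → 1 ≤ Real.logb 2 j := fun j hj => by
    rw [Real.le_logb_iff_rpow_le (by norm_num) (by positivity), Real.rpow_one]
    exact_mod_cast hj
  have h1 : 1 ≤ √(Real.logb 2 k) := Real.one_le_sqrt.2 (one_le k hk2)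
  have h2 : 1 ≤ √(k * Real.logb 2 p) := by
    refine Real.one_le_sqrt.2 (one_le_mul_of_one_le_of_one_le ?_ (one_le p hp.le))
    exact_mod_cast (by omega : 1 ≤ k)
  rw [le_div_iff₀ (by linarith)] at hk
  have h3 : C ≤ g k := by nlinarith
  rw [hχ₀]
  nlinarith

theorem tailBound_sqrt (l : ℕ) :
    tailBound √(l : ℝ) = ENNReal.ofReal (2 * Real.exp (-(l : ℝ) / 2)) := by
  rw [tailBound, Real.sq_sqrt (Nat.cast_nonneg l), ENNReal.ofReal_mul (by norm_num)]
  simp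

/-- A bound on the failure probability of decryption. -/
def failureBound (n m m' ℓ : ℕ) (t : ℝ) : ℝ :=
  m' * t + (ℓ * (32 * √((2 : ℝ) ^ n)⁻¹ + 5 * (m * t) + 4 * ((2 : ℝ) ^ n)⁻¹) +
    (ℓ * (m * t) + (m' * t + m * t)))

theorem le_failureBound {l n q m' c ℓ : ℕ} (hn : 2 ≤ n) (hq : 2 < q) (hc : c ≤ ℓ) :
    m' * tailBound √(l : ℝ) + (c * keyError n q √(l : ℝ) +
        (c * (gadgetLen n q * tailBound √(l : ℝ)) +
          (m' * tailBound √(l : ℝ) + gadgetLen n q * tailBound √(l : ℝ)))) ≤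
      ENNReal.ofReal (failureBound n (gadgetLen n q) m' ℓ (2 * Real.exp (-(l : ℝ) / 2))) := by
  have hkey : keyError n q √(l : ℝ) ≤ ENNReal.ofReal (32 * √((2 : ℝ) ^ n)⁻¹ +
      5 * (gadgetLen n q * (2 * Real.exp (-(l : ℝ) / 2))) + 4 * ((2 : ℝ) ^ n)⁻¹) := by
    rw [keyError, tailBound_sqrt]
    set t : ℝ := 2 * Real.exp (-(l : ℝ) / 2) with ht
    have ht0 : 0 ≤ t := by positivity
    rw [ENNReal.ofReal_add (by positivity) (by positivity),
      ENNReal.ofReal_add (by positivity) (by positivity)]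
    refine add_le_add (add_le_add (ENNReal.ofReal_le_ofReal (residue_mass_le hn hq)) ?_) ?_
    · rw [ENNReal.ofReal_mul (p := 5) (by positivity),
        ENNReal.ofReal_mul (p := (gadgetLen n q : ℝ)) (by positivity), ENNReal.ofReal_natCast,
        ENNReal.ofReal_ofNat]
    · rw [show (4 : ℝ) * ((2 : ℝ) ^ n)⁻¹ = 2 * (2 * ((2 : ℝ) ^ n)⁻¹) by ring,
        ENNReal.ofReal_mul (p := 2) (by positivity)]
      simp
  generalize keyError n q √(l : ℝ) = K at hkey ⊢
  rw [tailBound_sqrt, failureBound]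
  set t : ℝ := 2 * Real.exp (-(l : ℝ) / 2) with ht
  have ht0 : 0 ≤ t := by positivity
  have hc' : (c : ℝ≥0∞) ≤ ℓ := by exact_mod_cast hc
  rw [ENNReal.ofReal_add (by positivity) (by positivity),
    ENNReal.ofReal_add (by positivity) (by positivity),
    ENNReal.ofReal_add (by positivity) (by positivity),
    ENNReal.ofReal_add (by positivity) (by positivity),
    ENNReal.ofReal_mul (p := (m' : ℝ)) (by positivity),
    ENNReal.ofReal_mul (p := (ℓ : ℝ)) (by positivity),
    ENNReal.ofReal_mul (p := (ℓ : ℝ)) (by positivity),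
    ENNReal.ofReal_mul (p := (gadgetLen n q : ℝ)) (by positivity),
    ENNReal.ofReal_natCast, ENNReal.ofReal_natCast, ENNReal.ofReal_natCast]
  gcongr

theorem isNegligible_failureBound {n m m' ℓ : ℕ → ℕ}
    (hn : IsNegligible fun l => ((2 : ℝ) ^ n l)⁻¹) (hm : IsPolyBounded m)
    (hm' : IsPolyBounded m') (hℓ : IsPolyBounded ℓ) :
    IsNegligible fun l =>
      failureBound (n l) (m l) (m' l) (ℓ l) (2 * Real.exp (-(l : ℝ) / 2)) := by
  have ht : IsNegligible fun l : ℕ => 2 * Real.exp (-(l : ℝ) / 2) :=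
    isNegligible_exp_neg_half.const_mul 2
  have hmt := hm.mul_negligible ht
  have hm't := hm'.mul_negligible ht
  have hkey := ((hn.sqrt.const_mul 32).add (hmt.const_mul 5)).add (hn.const_mul 4)
  exact hm't.add ((hℓ.mul_negligible hkey).add ((hℓ.mul_negligible hmt).add (hm't.add hmt)))

end MAABIPFE

end

/-! ### Assembly: a negligible bound valid for every security parameter -/

theorem mainTheorem4
    -- lattice parameters, as functions of the security parameter
    (n q m' L : ℕ → ℕ) (χ χ' : ℕ → ℝ)
    [∀ l, Fact (q l).Prime] (hq : ∀ l, 2 < q l)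
    (hn : MAABIPFE.IsNegligible fun l => ((2 : ℝ) ^ n l)⁻¹)
    (hm : MAABIPFE.IsPolyBounded fun l => MAABIPFE.gadgetLen (n l) (q l))
    (hm' : MAABIPFE.IsPolyBounded m')
    (hχ : ∀ l, 0 < χ l) (hχ' : ∀ l, 0 < χ' l)
    -- the threshold `χ₀(n, q) = √(n log q) · ω(√(log n))`
    (χ₀ : ℕ → ℕ → ℝ) (g : ℕ → ℝ)
    (hg : Filter.Tendsto (fun k : ℕ => g k / √(Real.logb 2 k)) Filter.atTop Filter.atTop)
    (hχ₀ : ∀ k p : ℕ, χ₀ k p = √(k * Real.logb 2 p) * g k)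
    (hχχ₀ : ∀ l, χ₀ (n l) (q l) ≤ χ l)
    -- the trapdoor algorithms used by the scheme
    (T : MAABIPFE.TrapdoorAlgorithms) (hT : T.IsTrapdoor χ₀) :
    MAABIPFE.IsApproxCorrect
      (fun l => MAABIPFE.evIPFE T l (n l) (q l) (m' l) (χ l) (χ' l)) L
      (fun l => MAABIPFE.noiseBound l (n l) (q l) (m' l) (L l) (χ l) (χ' l)) := by
  intro ℓ hℓ
  let b : ℕ → ℝ := fun l => MAABIPFE.failureBound (n l) (MAABIPFE.gadgetLen (n l) (q l)) (m' l)
    (ℓ l) (2 * Real.exp (-(l : ℝ) / 2))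
  have hb : ∀ l, 0 ≤ b l := fun l => by
    simp only [b, MAABIPFE.failureBound]
    positivity
  -- The estimates need `n ≥ 2` and `χ ≥ 100`, which hold for all large `l`. For the other `l` the
  -- value 1 makes the claim trivial without affecting negligibility.
  refine ⟨fun l => if 2 ≤ n l ∧ 100 ≤ χ l then b l else 1, ?_, ?_⟩
  · refine (MAABIPFE.isNegligible_failureBound hn hm hm' hℓ).congr' ?_
    have hnt := hn.tendsto_of_two_pow_inv
    filter_upwards [hnt.eventually_ge_atTop 2, hnt.eventually
      (MAABIPFE.eventually_le_of_threshold hg hχ₀ (C := 100) (by norm_num))] with l hl hl'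
    rw [if_pos ⟨hl, (hl' _ (hq l)).trans (hχχ₀ l)⟩]
  · intro l u v gid A A' hA hAL hAℓ
    beta_reduce
    split_ifs with h
    · refine MAABIPFE.one_sub_le_toOuterMeasure _ _ (hb l) ?_
      exact (MAABIPFE.decryption_failure_le hT (by omega) (hq l) h.2 (hχ' l) (hχχ₀ l) u v gid A A'
        hA hAL).trans (MAABIPFE.le_failureBound h.1 (hq l) hAℓ)
    · simp
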